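/- Let $b\ge 2$ be an integer and let $G=\bigoplus_{i\ge 1}\mathbb Z/b\mathbb Z$ be the group of sequences over $\mathbb Z/b\mathbb Z$ with finitely many nonzero terms. For $y\in G$ let $\ell(y)$ be the position of the last nonzero term of $y$, with $\ell(\mathbf 0)=0$. Let $f:\{0,1,2,\dots\}\to[0,\infty)$ be (weakly) increasing and put $\mu(y)=b^{-2\ell(y)}f(\ell(y))$. For $\lambda\ge 0$ let $G_\mu(\lambda)$ be the random multigraph with vertex set $G$ in which the numbers of parallel edges between the pairs $x,y$ are independent Poisson random variables with means $\lambda\mu(y-x)$, and let $\lambda_c=\sup\{\lambda\ge 0:\mathbb P(G_\mu(\lambda)\text{ has an infinite component})=0\}\in[0,\infty]$. (a) If $f(\ell)=\Omega(a^{\sqrt{\ell}})$ as $\ell\to\infty$ for some $a>1$, then $\lambda_c<\infty$. (b) If $f(\ell)=o(\log \ell)$ and $f$ is ultimately concave (that is, $f(\ell)+f(\ell+2)\le 2f(\ell+1)$ for all sufficiently large $\ell$), then $\lambda_c=\infty$. (c) For a finite set $S\subset G$ let $\partial_\mu(S)=\sum_{x\in S,\,y\notin S}\mu(y-x)$. If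 $f(\ell)\to\infty$, then $\inf\{\partial_\mu(S): |S|=n\}\to\infty$ as $n\to\infty$. In particular, if $f(\ell)=\frac{\log \ell}{\log\log \ell}$ for all sufficiently large $\ell$, then $\lambda_c=\infty$ even though $\inf\{\partial_\mu(S): |S|=n\}\to\infty$ as $n\to\infty$. -/

import Mathlib

open scoped NNReal ENNReal Topology
open Filter Asymptotics

namespace LongRangePerc

/-- A nonnegative weight `μ` on an (additively written) group with `μ (-g) = μ g`. It is neither
required to be normalised nor to be finite. -/
structure SymmWeight (Γ : Type*) [AddGroup Γ] where
  /-- the weight of an element -/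
  wt : Γ → ℝ≥0
  wt_neg : ∀ g, wt (-g) = wt g

section Percolation

variable {Γ : Type*} [AddGroup Γ]

/-- The mean `lam * μ (-g + h)` of the number of parallel edges between `g` and `h`. -/
noncomputable def edgeRate (μ : SymmWeight Γ) (lam : ℝ≥0) : Sym2 Γ → ℝ≥0 :=
  Sym2.lift ⟨fun g h => lam * μ.wt (-g + h), fun g h => by
    have e : -h + g = -(-g + h) := by simp
    simp only [e, μ.wt_neg]⟩

/-- The law of the edge multiplicities of the random multigraph `Γ_μ(lam)`: independent Poisson
variables, one for each unordered pair. -/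
noncomputable def percLaw (μ : SymmWeight Γ) (lam : ℝ≥0) : MeasureTheory.Measure (Sym2 Γ → ℕ) :=
  MeasureTheory.Measure.infinitePi fun e => ProbabilityTheory.poissonMeasure (edgeRate μ lam e)

/-- The simple graph underlying a multigraph with edge multiplicities `ω`. -/
def graphOf {V : Type*} (ω : Sym2 V → ℕ) : SimpleGraph V where
  Adj x y := x ≠ y ∧ 0 < ω s(x, y)
  symm := ⟨fun x y h => ⟨h.1.symm, by rw [Sym2.eq_swap]; exact h.2⟩⟩
  loopless := ⟨fun _ h => h.1 rfl⟩

/-- The event that the multigraph has an infinite connected component. -/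
def infiniteComponent (V : Type*) : Set (Sym2 V → ℕ) :=
  {ω | ∃ C : (graphOf ω).ConnectedComponent, C.supp.Infinite}

/-- `sup {lam ≥ 0 | P (Γ_μ(lam) has an infinite component) = 0}`, as an element of `[0, ∞]`. -/
noncomputable def lambdaC (μ : SymmWeight Γ) : ℝ≥0∞ :=
  ⨆ (lam : ℝ≥0) (_ : percLaw μ lam (infiniteComponent Γ) = 0), (lam : ℝ≥0∞)

/-- The total `μ`-measure of the edges with exactly one endvertex in the finite set `S`. -/
noncomputable def boundary (μ : SymmWeight Γ) (S : Finset Γ) : ℝ≥0∞ :=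
  ∑ x ∈ S, ∑' y : {y : Γ // y ∉ S}, (μ.wt (-x + y.1) : ℝ≥0∞)

/-- The least size of the boundary of a set with `n` elements. -/
noncomputable def minBoundary (μ : SymmWeight Γ) (n : ℕ) : ℝ≥0∞ :=
  ⨅ (S : Finset Γ) (_ : S.card = n), boundary μ S

end Percolation

/-- The direct sum of countably many copies of `ℤ/bℤ`: the finitely supported sequences. -/
abbrev SumZ (b : ℕ) : Type := ℕ →₀ ZMod b

/-- The position of the last nonzero term, positions being counted from `1` (so that index `i`
is position `i + 1`), and `0` for the zero sequence. -/
def lastPos {b : ℕ} (y : SumZ b) : ℕ := y.support.sup fun i => i + 1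

theorem lastPos_neg {b : ℕ} (y : SumZ b) : lastPos (-y) = lastPos y := by
  unfold lastPos
  rw [Finsupp.support_neg]

/-- The weight `μ(y) = b^{-2ℓ(y)} f(ℓ(y))`. -/
noncomputable def zoomWeight (b : ℕ) (f : ℕ → ℝ≥0) : SymmWeight (SumZ b) where
  wt y := ((b : ℝ≥0) ^ (2 * lastPos y))⁻¹ * f (lastPos y)
  wt_neg y := by rw [lastPos_neg]

/-- Concavity of a function on the integers from some point on. -/
def UltimatelyConcave (f : ℕ → ℝ≥0) : Prop :=
  ∀ᶠ n in atTop, f n + f (n + 2) ≤ 2 * f (n + 1)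

end LongRangePerc

/-! Balls are cosets of finite subgroups, so the distance is an ultrametric and every point of a
ball is a centre of it. A sphere of radius l has about b^l points of weight b^{-2l} f(l), so a ball
of radius l is joined to the next sphere by edges of total mean λ f(l+1), up to a factor depending
on b. The three claims ask how fast f must grow for this to matter.

Boundary: if b^m ≥ 2|S|, then S fills at most half of the sphere of radius m+1 around any of its
points. For the least such m this leaves a boundary of order f(m+1) (`le_boundary`).

No percolation for f = o(log l): take the balls B_j of radius j^2. The edges between consecutive
annuli have mean at most λ f((j+2)^2) = o(log j), so they are all absent with probability at least
1/(j+2) for large j. These events are independent, and infinitely many occur by the second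
Borel-Cantelli lemma. The gap 2j+1 makes edges that jump over an annulus summably rare, so only
finitely many annuli are jumped. Hence almost surely infinitely many balls have no outgoing edge,
and every component is finite (`percLaw_infiniteComponent_eq_zero`). The function log l / log log l
is o(log l) and tends to infinity, so it combines this with the boundary claim.

Percolation for f of order at least a^{√l}: renormalise. A ball of level n+1 splits into b^k ≈
(n+2)^2 balls of level n. It is good if its subclusters are joined together and reach a prescribed
size, which allows one subball to fail. Badness forces two failing subballs or two unjoined good
ones, so the failure probabilities obey p_{n+1} ≤ b^{2k}(p_n^2 + q_n)
(`percLaw_cluster_succ_eq_empty_le`). The size lost is a convergent product, and f(l_n) ≥ c(n+2)^5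
makes q_n tiny for large λ. Then Σ p_n < 1, and with positive probability the nested clusters of 0
are all nonempty, which gives an infinite component. -/

namespace LongRangePerc

open MeasureTheory ProbabilityTheory

/-! ### Ultrametric geometry of the group. -/

section Balls

variable {b : ℕ} [NeZero b]

/-- The finite set of all points that agree with `x` outside the set `I` of coordinates. -/
noncomputable def block (I : Finset ℕ) (x : SumZ b) : Finset (SumZ b) :=
  (I.finsupp fun _ => Finset.univ).map (addLeftEmbedding x)

theorem mem_block {I : Finset ℕ} {x y : SumZ b} : y ∈ block I x ↔ ∀ i ∉ I, y i = x i := by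
  unfold block
  rw [Finset.mem_map]
  constructor
  · rintro ⟨v, hv, rfl⟩ i hi
    have : v i = 0 := by
      have := (Finset.mem_finsupp_iff.1 hv).1
      by_contra h
      exact hi (this (Finsupp.mem_support_iff.2 h))
    simp [this]
  · intro h
    refine ⟨-x + y, ?_, by simp⟩
    rw [Finset.mem_finsupp_iff]
    refine ⟨fun i hi => ?_, fun i _ => Finset.mem_univ _⟩
    by_contra hI
    exact (Finsupp.mem_support_iff.1 hi) (by simp [h i hI])

theorem card_block (I : Finset ℕ) (x : SumZ b) : (block I x).card = b ^ I.card := by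
  unfold block
  rw [Finset.card_map, Finset.card_finsupp]
  simp [ZMod.card]

/-- The ball of radius `l` around `x`: all points that agree with `x` from index `l` on. -/
noncomputable def ball (x : SumZ b) (l : ℕ) : Finset (SumZ b) := block (Finset.range l) x

theorem mem_ball {x y : SumZ b} {l : ℕ} : y ∈ ball x l ↔ ∀ i, l ≤ i → y i = x i := by
  simp [ball, mem_block]

theorem card_ball (x : SumZ b) (l : ℕ) : (ball x l).card = b ^ l := by
  simp [ball, card_block]

theorem self_mem_ball (x : SumZ b) (l : ℕ) : x ∈ ball x l := mem_ball.2 fun _ _ => rfl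

theorem ball_mono (x : SumZ b) {l m : ℕ} (h : l ≤ m) : ball x l ⊆ ball x m :=
  fun _ hy => mem_ball.2 fun i hi => mem_ball.1 hy i (h.trans hi)

/-- The ultrametric property; it lets sums over annuli around 0 be recentred at any interior point.
-/
theorem ball_eq {x y : SumZ b} {l : ℕ} (h : y ∈ ball x l) : ball y l = ball x l := by
  ext z
  rw [mem_ball] at h
  simp only [mem_ball]
  exact forall₂_congr fun i hi => by rw [h i hi]

theorem lastPos_le_iff {b : ℕ} {y : SumZ b} {l : ℕ} : lastPos y ≤ l ↔ ∀ i, l ≤ i → y i = 0 := by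
  unfold lastPos
  rw [Finset.sup_le_iff]
  constructor
  · intro h i hi
    by_contra h0
    have := h i (Finsupp.mem_support_iff.2 h0)
    omega
  · intro h i hi
    by_contra h0
    exact Finsupp.mem_support_iff.1 hi (h i (by omega))

theorem mem_ball_iff_lastPos {x y : SumZ b} {l : ℕ} : y ∈ ball x l ↔ lastPos (-x + y) ≤ l := by
  rw [mem_ball, lastPos_le_iff]
  refine forall₂_congr fun i _ => ?_
  rw [Finsupp.add_apply, Finsupp.neg_apply, neg_add_eq_zero, eq_comm]

theorem mem_ball_zero_lastPos (x : SumZ b) : x ∈ ball 0 (lastPos x) := by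
  rw [mem_ball_iff_lastPos]; simp

theorem card_sphere (x : SumZ b) (l : ℕ) :
    (ball x (l + 1) \ ball x l).card = b ^ (l + 1) - b ^ l := by
  rw [Finset.card_sdiff_of_subset (ball_mono x l.le_succ), card_ball, card_ball]

theorem lastPos_of_mem_sphere {x y : SumZ b} {l : ℕ} (h : y ∈ ball x (l + 1) \ ball x l) :
    lastPos (-x + y) = l + 1 := by
  rw [Finset.mem_sdiff, mem_ball_iff_lastPos, mem_ball_iff_lastPos] at h
  omega

theorem zoomWeight_wt_le {f : ℕ → ℝ≥0} (hf : Monotone f) {y : SumZ b} {l m : ℕ}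
    (h1 : l ≤ lastPos y) (h2 : lastPos y ≤ m) :
    ((b : ℝ≥0) ^ (2 * m))⁻¹ * f l ≤ (zoomWeight b f).wt y := by
  have hb : 1 ≤ b := NeZero.one_le
  have hb' : (1 : ℝ≥0) ≤ b := by exact_mod_cast hb
  change _ ≤ ((b : ℝ≥0) ^ (2 * lastPos y))⁻¹ * f (lastPos y)
  gcongr
  · exact hf h1

end Balls

/-! ### Edge boundaries of finite sets. -/

section Boundary

/-- With m the least exponent such that b^m ≥ 2|S|, each point of S has at least b^m/2 points
outside S on its sphere of radius m+1. Minimality of m gives |S| ≥ b^m/(2b), and the powers of b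
cancel down to 1/(4b^3). -/
theorem le_boundary {b : ℕ} (hb : 2 ≤ b) (f : ℕ → ℝ≥0) (S : Finset (SumZ b)) (hS : S.Nonempty) :
    (((4 * (b : ℝ≥0) ^ 3)⁻¹ * f (Nat.clog b (2 * S.card) + 1) : ℝ≥0) : ℝ≥0∞) ≤
      boundary (zoomWeight b f) S := by
  have : NeZero b := ⟨by omega⟩
  have hn : 0 < S.card := hS.card_pos
  obtain ⟨m, hm⟩ : ∃ m, Nat.clog b (2 * S.card) = m := ⟨_, rfl⟩
  have hm1 : 2 * S.card ≤ b ^ m := hm ▸ Nat.le_pow_clog (by omega) _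
  have hm2 : b ^ m ≤ 2 * S.card * b := by
    have h : 1 < 2 * S.card := by omega
    have h1 := Nat.pow_pred_clog_lt_self (b := b) (by omega) h
    have h2 : 0 < m := hm ▸ Nat.clog_pos (by omega) h
    rw [hm] at h1
    calc b ^ m = b ^ (m - 1) * b := by rw [← pow_succ]; congr 1; omega
      _ ≤ _ := Nat.mul_le_mul_right _ h1.le
  rw [hm]
  set w : ℝ≥0 := ((b : ℝ≥0) ^ (2 * (m + 1)))⁻¹ * f (m + 1) with hw
  have key : ∀ x ∈ S, (((b : ℝ≥0) ^ m / 2 * w : ℝ≥0) : ℝ≥0∞) ≤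
      ∑' y : {y : SumZ b // y ∉ S}, ((zoomWeight b f).wt (-x + y.1) : ℝ≥0∞) := by
    intro x _
    set T := (ball x (m + 1) \ ball x m) \ S with hT
    have hcard : (b : ℝ≥0) ^ m / 2 ≤ T.card := by
      have h1 : b ^ (m + 1) - b ^ m - S.card ≤ T.card := by
        rw [hT, ← card_sphere x m]; exact Finset.le_card_sdiff _ _
      have h2 : 2 * b ^ m ≤ b ^ (m + 1) := by
        rw [pow_succ, mul_comm]; exact Nat.mul_le_mul_left _ hb
      have h3 : b ^ m ≤ 2 * T.card := by omega
      have h4 : (b : ℝ≥0) ^ m ≤ 2 * T.card := by exact_mod_cast h3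
      rw [div_le_iff₀ (by norm_num), mul_comm]; exact h4
    have hsub : ∀ y ∈ T, y ∉ S := fun y hy => (Finset.mem_sdiff.1 hy).2
    calc (((b : ℝ≥0) ^ m / 2 * w : ℝ≥0) : ℝ≥0∞) ≤ ((T.card * w : ℝ≥0) : ℝ≥0∞) := by
          gcongr
      _ = ∑ y ∈ T, ((zoomWeight b f).wt (-x + y) : ℝ≥0∞) := by
          rw [Finset.sum_congr rfl (g := fun _ => (w : ℝ≥0∞))]
          · simp
          · intro y hy
            have := lastPos_of_mem_sphere (Finset.mem_sdiff.1 hy).1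
            simp only [zoomWeight, this, hw]
      _ = ∑ y ∈ T.subtype (· ∉ S), ((zoomWeight b f).wt (-x + y.1) : ℝ≥0∞) :=
          (Finset.sum_subtype_of_mem (fun y => ((zoomWeight b f).wt (-x + y) : ℝ≥0∞)) hsub).symm
      _ ≤ _ := ENNReal.sum_le_tsum _
  calc _ ≤ ((S.card * ((b : ℝ≥0) ^ m / 2 * w) : ℝ≥0) : ℝ≥0∞) := by
        have hb0 : (0 : ℝ≥0) < b := by exact_mod_cast (by omega : 0 < b)
        have h : (b : ℝ≥0) ^ m / (2 * b) ≤ S.card := by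
          rw [div_le_iff₀ (by positivity)]
          have : (b : ℝ≥0) ^ m ≤ 2 * S.card * b := by exact_mod_cast hm2
          linarith
        norm_cast
        push_cast
        calc (4 * (b : ℝ≥0) ^ 3)⁻¹ * f (m + 1)
            = (b : ℝ≥0) ^ m / (2 * b) * ((b : ℝ≥0) ^ m / 2 * w) := by
              rw [hw]
              field_simp
              ring
          _ ≤ _ := by gcongr
    _ = ∑ x ∈ S, (((b : ℝ≥0) ^ m / 2 * w : ℝ≥0) : ℝ≥0∞) := by simp
    _ ≤ _ := Finset.sum_le_sum key

theorem tendsto_minBoundary {b : ℕ} (hb : 2 ≤ b) {f : ℕ → ℝ≥0} (hf : Monotone f)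
    (hlim : Tendsto f atTop atTop) :
    Tendsto (minBoundary (zoomWeight b f)) atTop (𝓝 ⊤) := by
  have hb0 : (0 : ℝ≥0) < b := by exact_mod_cast (by omega : 0 < b)
  rw [ENNReal.tendsto_nhds_top_iff_nnreal]
  intro C
  obtain ⟨L, hL⟩ := (hlim.eventually_ge_atTop (4 * (b : ℝ≥0) ^ 3 * (C + 1))).exists
  filter_upwards [eventually_ge_atTop (b ^ L + 1)] with n hn
  refine lt_of_lt_of_le (b := ((C + 1 : ℝ≥0) : ℝ≥0∞)) (by norm_cast; exact lt_add_one C) ?_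
  refine le_iInf₂ fun S hS => ?_
  refine le_trans ?_ (le_boundary hb f S (Finset.card_pos.1 (by omega)))
  norm_cast
  rw [le_inv_mul_iff₀ (by positivity)]
  refine le_trans (by exact_mod_cast hL) (hf (?_ : L ≤ _))
  have : L ≤ Nat.clog b (2 * S.card) := by
    by_contra h
    have h1 := (Nat.clog_le_iff_le_pow (b := b) (x := 2 * S.card) (y := L) (by omega)).1 (by omega)
    omega
  omega

end Boundary

/-! ### Independence of events on finitely many edges. -/

section Law

variable {Γ : Type*} [AddGroup Γ] (μ : SymmWeight Γ) (lam : ℝ≥0)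

instance : IsProbabilityMeasure (percLaw μ lam) := by
  unfold percLaw; infer_instance

theorem percLaw_forall_eq_zero (E : Finset (Sym2 Γ)) :
    percLaw μ lam {ω | ∀ e ∈ E, ω e = 0} =
      ENNReal.ofReal (Real.exp (-∑ e ∈ E, (edgeRate μ lam e : ℝ))) := by
  have h : {ω : Sym2 Γ → ℕ | ∀ e ∈ E, ω e = 0} = Set.pi E fun _ => {0} := by
    ext; simp [Set.mem_pi]
  rw [h, percLaw, Measure.infinitePi_pi _ (fun _ _ => measurableSet_singleton _)]
  simp only [poissonMeasure_singleton]
  rw [← ENNReal.ofReal_prod_of_nonneg (fun _ _ => by positivity), ← Finset.sum_neg_distrib,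
    Real.exp_sum]
  simp

theorem percLaw_ne_zero_le (e : Sym2 Γ) :
    percLaw μ lam {ω | ω e ≠ 0} ≤ edgeRate μ lam e := by
  have h1 : percLaw μ lam {ω | ω e = 0} = ENNReal.ofReal (Real.exp (-(edgeRate μ lam e : ℝ))) := by
    simpa using percLaw_forall_eq_zero μ lam {e}
  have hm : MeasurableSet {ω : Sym2 Γ → ℕ | ω e = 0} :=
    measurable_pi_apply e (measurableSet_singleton 0)
  have h2 : {ω : Sym2 Γ → ℕ | ω e ≠ 0} = {ω | ω e = 0}ᶜ := rfl
  rw [h2, prob_compl_eq_one_sub hm, h1, ← ENNReal.ofReal_one,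
    ← ENNReal.ofReal_sub _ (Real.exp_pos _).le, ← ENNReal.ofReal_coe_nnreal]
  apply ENNReal.ofReal_le_ofReal
  have := Real.add_one_le_exp (-(edgeRate μ lam e : ℝ))
  linarith

/-- An event that depends on finitely many edges is the preimage of a set of restrictions. -/
theorem exists_eq_preimage_restrict {V : Type*} {T : Finset (Sym2 V)} {A : Set (Sym2 V → ℕ)}
    (hA : DependsOn (· ∈ A) (T : Set (Sym2 V))) :
    ∃ B : Set (T → ℕ), A = (fun (ω : Sym2 V → ℕ) (e : T) => ω e) ⁻¹' B := by
  refine ⟨(fun (ω : Sym2 V → ℕ) (e : T) => ω e) '' A, ?_⟩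
  ext ω
  constructor
  · exact fun h => ⟨ω, h, rfl⟩
  · rintro ⟨ω', h', he⟩
    have : (ω' ∈ A) = (ω ∈ A) := hA fun e het => congrFun he ⟨e, het⟩
    exact this ▸ h'

/-- Finitely many edges have only countably many joint multiplicities, so every set of restrictions
is measurable. -/
theorem measurableSet_of_dependsOn {V : Type*} {T : Finset (Sym2 V)} {A : Set (Sym2 V → ℕ)}
    (hA : DependsOn (· ∈ A) (T : Set (Sym2 V))) : MeasurableSet A := by
  obtain ⟨B, rfl⟩ := exists_eq_preimage_restrict hA
  exact (measurable_pi_lambda _ fun e => measurable_pi_apply _) B.to_countable.measurableSet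

theorem percLaw_inter_of_dependsOn {T₁ T₂ : Finset (Sym2 Γ)} (hT : Disjoint T₁ T₂)
    {A₁ A₂ : Set (Sym2 Γ → ℕ)} (h₁ : DependsOn (· ∈ A₁) (T₁ : Set (Sym2 Γ)))
    (h₂ : DependsOn (· ∈ A₂) (T₂ : Set (Sym2 Γ))) :
    percLaw μ lam (A₁ ∩ A₂) = percLaw μ lam A₁ * percLaw μ lam A₂ := by
  obtain ⟨B₁, rfl⟩ := exists_eq_preimage_restrict h₁
  obtain ⟨B₂, rfl⟩ := exists_eq_preimage_restrict h₂
  have hind : iIndepFun (fun (e : Sym2 Γ) (ω : Sym2 Γ → ℕ) => ω e) (percLaw μ lam) :=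
    iIndepFun_infinitePi (P := fun e => poissonMeasure (edgeRate μ lam e)) (X := fun _ n => n)
      fun _ => measurable_id
  exact (hind.indepFun_finset T₁ T₂ hT fun e => measurable_pi_apply e).measure_inter_preimage_eq_mul
    _ _ B₁.to_countable.measurableSet B₂.to_countable.measurableSet

end Law

/-! ### Absence of percolation when f = o(log l). -/

section Subcritical

theorem edgeRate_mk {Γ : Type*} [AddGroup Γ] (μ : SymmWeight Γ) (lam : ℝ≥0) (x y : Γ) :
    edgeRate μ lam s(x, y) = lam * μ.wt (-x + y) := rfl

variable {b : ℕ} [NeZero b]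

/-- The sphere of radius k contributes at most f(k) b^{-k}, and b^{-k} ≤ b^{-(k-1)} - b^{-k} because
b ≥ 2. Keeping the difference on the right makes the induction telescope. -/
theorem sum_wt_annulus_le (hb : 2 ≤ b) {f : ℕ → ℝ≥0} (hf : Monotone f) (x : SumZ b) {l m : ℕ}
    (hlm : l ≤ m) :
    ∑ y ∈ ball x m \ ball x l, ((zoomWeight b f).wt (-x + y) : ℝ) ≤
      f m * (((b : ℝ) ^ l)⁻¹ - ((b : ℝ) ^ m)⁻¹) := by
  have hb' : (2 : ℝ) ≤ b := by exact_mod_cast hb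
  induction m, hlm using Nat.le_induction with
  | base => simp
  | succ m hlm ih =>
    have hsub : ball x (m + 1) \ ball x l =
        (ball x m \ ball x l) ∪ (ball x (m + 1) \ ball x m) := by
      ext y
      have h1 := @ball_mono b _ x _ _ hlm y
      have h2 := @ball_mono b _ x _ _ m.le_succ y
      simp only [Finset.mem_sdiff, Finset.mem_union]
      tauto
    have hdisj : Disjoint (ball x m \ ball x l) (ball x (m + 1) \ ball x m) :=
      Finset.disjoint_left.2 fun y h1 h2 =>
        (Finset.mem_sdiff.1 h2).2 (Finset.mem_sdiff.1 h1).1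
    have hs : ∑ y ∈ ball x (m + 1) \ ball x m, ((zoomWeight b f).wt (-x + y) : ℝ) ≤
        f (m + 1) * ((b : ℝ) ^ (m + 1))⁻¹ := by
      have h1 : ∀ y ∈ ball x (m + 1) \ ball x m, ((zoomWeight b f).wt (-x + y) : ℝ) ≤
          ((b : ℝ) ^ (2 * (m + 1)))⁻¹ * f (m + 1) := by
        intro y hy
        simp [zoomWeight, lastPos_of_mem_sphere hy]
      refine (Finset.sum_le_card_nsmul _ _ _ h1).trans ?_
      have h2 : ((ball x (m + 1) \ ball x m).card : ℝ) ≤ (b : ℝ) ^ (m + 1) := by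
        rw [card_sphere]; exact_mod_cast Nat.sub_le _ _
      rw [nsmul_eq_mul]
      calc _ ≤ (b : ℝ) ^ (m + 1) * (((b : ℝ) ^ (2 * (m + 1)))⁻¹ * f (m + 1)) := by gcongr
        _ = _ := by field_simp; ring
    rw [hsub, Finset.sum_union hdisj]
    have hff : (f m : ℝ) ≤ f (m + 1) := by exact_mod_cast hf m.le_succ
    have hpos : 0 ≤ ((b : ℝ) ^ l)⁻¹ - ((b : ℝ) ^ m)⁻¹ :=
      sub_nonneg.2 (inv_anti₀ (by positivity) (pow_le_pow_right₀ (by linarith) hlm))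
    have h3 : 2 * ((b : ℝ) ^ (m + 1))⁻¹ ≤ ((b : ℝ) ^ m)⁻¹ := by
      rw [pow_succ, mul_inv, mul_comm, mul_assoc]
      refine mul_le_of_le_one_right (by positivity) ?_
      rw [inv_mul_le_iff₀ (by linarith)]; linarith
    have h4 := mul_le_mul_of_nonneg_right hff hpos
    have h5 := mul_le_mul_of_nonneg_left h3 (f (m + 1)).coe_nonneg
    linarith

/-- Edges between the annuli `B_{r(j+1)} \ B_{r(j)}` and `B_{r(j+2)} \ B_{r(j+1)}`. -/
noncomputable def annulusEdges (b : ℕ) [NeZero b] (r : ℕ → ℕ) (j : ℕ) : Finset (Sym2 (SumZ b)) :=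
  open Classical in
  ((ball 0 (r (j + 1)) \ ball 0 (r j)) ×ˢ (ball 0 (r (j + 2)) \ ball 0 (r (j + 1)))).image
    fun p => s(p.1, p.2)

theorem mem_annulusEdges {r : ℕ → ℕ} {j : ℕ} {e : Sym2 (SumZ b)} :
    e ∈ annulusEdges b r j ↔ ∃ x ∈ ball (0 : SumZ b) (r (j + 1)) \ ball 0 (r j),
      ∃ y ∈ ball (0 : SumZ b) (r (j + 2)) \ ball 0 (r (j + 1)), s(x, y) = e := by
  simp only [annulusEdges, Finset.mem_image, Finset.mem_product, Prod.exists]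
  constructor
  · rintro ⟨x, y, ⟨hx, hy⟩, h⟩; exact ⟨x, hx, y, hy, h⟩
  · rintro ⟨x, hx, y, hy, h⟩; exact ⟨x, y, ⟨hx, hy⟩, h⟩

theorem annulus_index_unique {r : ℕ → ℕ} (hr : Monotone r) {i j : ℕ} {x : SumZ b}
    (hi : x ∈ ball 0 (r (i + 1)) \ ball 0 (r i)) (hj : x ∈ ball 0 (r (j + 1)) \ ball 0 (r j)) :
    i = j := by
  rw [Finset.mem_sdiff] at hi hj
  by_contra h
  rcases lt_or_gt_of_ne h with h | h
  · exact hj.2 (ball_mono 0 (hr h) hi.1)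
  · exact hi.2 (ball_mono 0 (hr h) hj.1)

theorem pairwise_disjoint_annulusEdges {r : ℕ → ℕ} (hr : Monotone r) :
    Pairwise fun i j => Disjoint (annulusEdges b r i) (annulusEdges b r j) := by
  intro i j hij
  refine Finset.disjoint_left.2 fun e hi hj => hij ?_
  obtain ⟨x, hx, y, hy, rfl⟩ := mem_annulusEdges.1 hi
  obtain ⟨x', hx', y', hy', h⟩ := mem_annulusEdges.1 hj
  rw [Sym2.eq_iff] at h
  rcases h with ⟨rfl, rfl⟩ | ⟨rfl, rfl⟩
  · exact annulus_index_unique hr hx hx'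
  · have h1 := annulus_index_unique hr hx hy'
    have h2 := annulus_index_unique hr hy hx'
    omega

/-- At most b^{r(j+1)} inner endpoints each see weight at most f(r(j+2)) b^{-r(j+1)} in the outer
annulus, after recentring the balls at the inner endpoint. -/
theorem sum_edgeRate_annulusEdges_le (hb : 2 ≤ b) {f : ℕ → ℝ≥0} (hf : Monotone f) (lam : ℝ≥0)
    {r : ℕ → ℕ} (hr : Monotone r) (j : ℕ) :
    ∑ e ∈ annulusEdges b r j, (edgeRate (zoomWeight b f) lam e : ℝ) ≤ lam * f (r (j + 2)) := by
  have hb' : (0 : ℝ) < b := by exact_mod_cast (by omega : 0 < b)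
  refine (Finset.sum_image_le_of_nonneg (fun _ _ => NNReal.coe_nonneg _)).trans ?_
  rw [Finset.sum_product]
  have key : ∀ x ∈ ball (0 : SumZ b) (r (j + 1)) \ ball 0 (r j),
      ∑ y ∈ ball (0 : SumZ b) (r (j + 2)) \ ball 0 (r (j + 1)),
        (edgeRate (zoomWeight b f) lam s(x, y) : ℝ) ≤
      lam * (f (r (j + 2)) * ((b : ℝ) ^ r (j + 1))⁻¹) := by
    intro x hx
    have hx1 := (Finset.mem_sdiff.1 hx).1
    have hrj : r (j + 1) ≤ r (j + 2) := hr (by omega)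
    rw [← ball_eq hx1, ← ball_eq (ball_mono 0 hrj hx1)]
    simp only [edgeRate_mk, NNReal.coe_mul]
    rw [← Finset.mul_sum]
    gcongr
    refine (sum_wt_annulus_le hb hf x hrj).trans ?_
    gcongr
    have : 0 ≤ ((b : ℝ) ^ r (j + 2))⁻¹ := by positivity
    linarith
  refine (Finset.sum_le_card_nsmul _ _ _ key).trans ?_
  have h2 : ((ball (0 : SumZ b) (r (j + 1)) \ ball 0 (r j)).card : ℝ) ≤ (b : ℝ) ^ r (j + 1) := by
    have := Finset.card_le_card (Finset.sdiff_subset (s := ball (0 : SumZ b) (r (j + 1)))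
      (t := ball 0 (r j)))
    rw [card_ball] at this
    exact_mod_cast this
  rw [nsmul_eq_mul]
  calc _ ≤ (b : ℝ) ^ r (j + 1) * (lam * (f (r (j + 2)) * ((b : ℝ) ^ r (j + 1))⁻¹)) := by gcongr
    _ = _ := by field_simp

/-- The event that there is an edge from the ball of radius `l` to outside the ball of
radius `m`. -/
def longEdge (b : ℕ) [NeZero b] (l m : ℕ) : Set (Sym2 (SumZ b) → ℕ) :=
  {ω | ∃ x ∈ ball (0 : SumZ b) l, ∃ y ∉ ball (0 : SumZ b) m, ω s(x, y) ≠ 0}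

/-- Union bound over edges, sorted by the sphere of radius m+i+1 that contains the outer endpoint.
-/
theorem percLaw_longEdge_le (f : ℕ → ℝ≥0) (lam : ℝ≥0) {l m : ℕ} (hlm : l ≤ m) :
    percLaw (zoomWeight b f) lam (longEdge b l m) ≤
      ∑' i, ((lam * ((b : ℝ≥0) ^ l * ((b : ℝ≥0) ^ (m + i + 1))⁻¹ * f (m + i + 1)) : ℝ≥0) :
        ℝ≥0∞) := by
  have hb' : (b : ℝ≥0) ≠ 0 := by exact_mod_cast NeZero.ne b
  have hsub : longEdge b l m ⊆ ⋃ i, ⋃ x ∈ ball (0 : SumZ b) l,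
      ⋃ y ∈ ball (0 : SumZ b) (m + i + 1) \ ball 0 (m + i), {ω | ω s(x, y) ≠ 0} := by
    rintro ω ⟨x, hx, y, hy, h⟩
    have hy' : m < lastPos y := by
      by_contra hle
      exact hy (ball_mono 0 (not_lt.1 hle) (mem_ball_zero_lastPos y))
    obtain ⟨i, hi⟩ := Nat.exists_eq_add_of_lt hy'
    simp only [Set.mem_iUnion]
    refine ⟨i, x, hx, y, ?_, h⟩
    rw [Finset.mem_sdiff, mem_ball_iff_lastPos, mem_ball_iff_lastPos]
    simp only [neg_zero, zero_add]
    omega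
  refine (measure_mono hsub).trans ((measure_iUnion_le _).trans (ENNReal.tsum_le_tsum fun i => ?_))
  refine (measure_biUnion_finset_le _ _).trans ?_
  have key : ∀ x ∈ ball (0 : SumZ b) l, percLaw (zoomWeight b f) lam
      (⋃ y ∈ ball (0 : SumZ b) (m + i + 1) \ ball 0 (m + i), {ω | ω s(x, y) ≠ 0}) ≤
      ((lam * (((b : ℝ≥0) ^ (m + i + 1))⁻¹ * f (m + i + 1)) : ℝ≥0) : ℝ≥0∞) := by
    intro x hx
    refine (measure_biUnion_finset_le _ _).trans ?_
    have h1 : ∀ y ∈ ball (0 : SumZ b) (m + i + 1) \ ball 0 (m + i),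
        percLaw (zoomWeight b f) lam {ω | ω s(x, y) ≠ 0} ≤
        ((lam * (((b : ℝ≥0) ^ (2 * (m + i + 1)))⁻¹ * f (m + i + 1)) : ℝ≥0) : ℝ≥0∞) := by
      intro y hy
      refine (percLaw_ne_zero_le _ _ _).trans ?_
      rw [← ball_eq (ball_mono 0 (by omega : l ≤ m + i + 1) hx),
        ← ball_eq (ball_mono 0 (by omega : l ≤ m + i) hx)] at hy
      rw [edgeRate_mk]
      simp [zoomWeight, lastPos_of_mem_sphere hy]
    refine (Finset.sum_le_card_nsmul _ _ _ h1).trans ?_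
    rw [nsmul_eq_mul, card_sphere]
    have h2 : ((b ^ (m + i + 1) - b ^ (m + i) : ℕ) : ℝ≥0) ≤ (b : ℝ≥0) ^ (m + i + 1) := by
      exact_mod_cast Nat.sub_le _ _
    calc _ ≤ (((b : ℝ≥0) ^ (m + i + 1) *
            (lam * (((b : ℝ≥0) ^ (2 * (m + i + 1)))⁻¹ * f (m + i + 1))) : ℝ≥0) : ℝ≥0∞) := by
          rw [ENNReal.coe_mul (_ ^ _)]
          gcongr
          rw [← ENNReal.coe_natCast]
          exact_mod_cast h2
      _ = _ := by
          congr 1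
          rw [two_mul, pow_add _ (m + i + 1) (m + i + 1)]
          field_simp
  refine (Finset.sum_le_card_nsmul _ _ _ key).trans ?_
  rw [nsmul_eq_mul, card_ball, ← ENNReal.coe_natCast, ← ENNReal.coe_mul,
    ENNReal.coe_le_coe]
  exact le_of_eq (by push_cast; ring)

theorem ae_frequently_annulusEdges_eq_zero (hb : 2 ≤ b) {f : ℕ → ℝ≥0} (hf : Monotone f)
    (hlog : (fun l : ℕ => (f l : ℝ)) =o[atTop] (fun l : ℕ => Real.log (l : ℝ))) (lam : ℝ≥0) :
    ∀ᵐ ω ∂percLaw (zoomWeight b f) lam,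
      ∃ᶠ j in atTop, ∀ e ∈ annulusEdges b (fun j => j ^ 2) j, ω e = 0 := by
  have hr : Monotone fun j : ℕ => j ^ 2 := fun i j h => Nat.pow_le_pow_left h 2
  set E := annulusEdges b (fun j => j ^ 2) with hE
  set D : ℕ → Set (Sym2 (SumZ b) → ℕ) := fun j => {ω | ∀ e ∈ E j, ω e = 0} with hD
  have hDm : ∀ j, MeasurableSet (D j) := fun j => by
    refine measurableSet_of_dependsOn (T := E j) fun ω ω' h => ?_
    exact propext (forall₂_congr fun e he => by rw [h e he])
  have hind : iIndepSet D (percLaw (zoomWeight b f) lam) := by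
    rw [iIndepSet_iff_meas_biInter hDm]
    intro s
    classical
    have h1 : ⋂ i ∈ s, D i = {ω | ∀ e ∈ s.biUnion E, ω e = 0} := by
      ext ω
      simp only [hD, Set.mem_iInter, Set.mem_ofPred_eq, Finset.mem_biUnion]
      exact ⟨fun h e ⟨i, hi, he⟩ => h i hi e he, fun h i hi e he => h e ⟨i, hi, he⟩⟩
    rw [h1, percLaw_forall_eq_zero, Finset.sum_biUnion
      ((pairwise_disjoint_annulusEdges hr).set_pairwise _), ← Finset.sum_neg_distrib, Real.exp_sum,
      ENNReal.ofReal_prod_of_nonneg (fun _ _ => (Real.exp_pos _).le)]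
    exact Finset.prod_congr rfl fun i _ => (percLaw_forall_eq_zero _ _ _).symm
  have hsum : ∑' j, percLaw (zoomWeight b f) lam (D j) = ⊤ := by
    by_contra hne
    have hs := ENNReal.summable_toReal hne
    have hev : ∀ᶠ j : ℕ in atTop,
        ((j + 2 : ℕ) : ℝ)⁻¹ ≤ (percLaw (zoomWeight b f) lam (D j)).toReal := by
      -- The factor 2 absorbs log((j+2)^2) = 2 log(j+2), and λ/(λ+1) ≤ 1 does the rest: the mean is
      -- at most log(j+2), so the probabilities dominate a harmonic series.
      have h1 := hlog.bound (c := (2 * ((lam : ℝ) + 1))⁻¹) (by positivity)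
      have h2 : Tendsto (fun j : ℕ => (j + 2) ^ 2) atTop atTop :=
        tendsto_atTop_mono (fun j => show j ≤ (j + 2) ^ 2 by nlinarith) tendsto_id
      filter_upwards [h2.eventually h1] with j hj
      rw [percLaw_forall_eq_zero, ENNReal.toReal_ofReal (Real.exp_pos _).le]
      have h3 := sum_edgeRate_annulusEdges_le hb hf lam hr j
      have hjpos : (0 : ℝ) < ((j + 2 : ℕ) : ℝ) := by positivity
      have hl0 : 0 ≤ Real.log ((j + 2 : ℕ) : ℝ) :=
        Real.log_nonneg (by exact_mod_cast (by omega : 1 ≤ j + 2))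
      rw [← Real.exp_log (inv_pos.2 hjpos), Real.log_inv]
      apply Real.exp_le_exp.2
      apply neg_le_neg
      refine h3.trans ?_
      have h4 : (f ((j + 2) ^ 2) : ℝ) ≤
          (2 * ((lam : ℝ) + 1))⁻¹ * (2 * Real.log ((j + 2 : ℕ) : ℝ)) := by
        have h5 : Real.log (((j + 2) ^ 2 : ℕ) : ℝ) = 2 * Real.log ((j + 2 : ℕ) : ℝ) := by
          rw [Nat.cast_pow, Real.log_pow]; norm_num
        rw [h5, Real.norm_of_nonneg (NNReal.coe_nonneg _),
          Real.norm_of_nonneg (by positivity)] at hj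
        exact hj
      calc (lam : ℝ) * f ((j + 2) ^ 2)
          ≤ lam * ((2 * ((lam : ℝ) + 1))⁻¹ * (2 * Real.log ((j + 2 : ℕ) : ℝ))) := by gcongr
        _ = (lam / (lam + 1)) * Real.log ((j + 2 : ℕ) : ℝ) := by field_simp
        _ ≤ _ := by
          refine mul_le_of_le_one_left hl0 ?_
          rw [div_le_one (by positivity)]; linarith
    have h6 : Summable fun j : ℕ => ((j + 2 : ℕ) : ℝ)⁻¹ := by
      refine Summable.of_norm_bounded_eventually_nat hs ?_
      filter_upwards [hev] with j hj
      rwa [Real.norm_of_nonneg (by positivity)]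
    exact Real.not_summable_natCast_inv ((summable_nat_add_iff 2).1 h6)
  have hone := measure_limsup_eq_one hDm hind hsum
  have hae := (prob_compl_eq_zero_iff (MeasurableSet.measurableSet_limsup hDm)).2 hone
  filter_upwards [compl_mem_ae_iff.2 hae] with ω hω
  rw [compl_compl, Filter.mem_limsup_iff_frequently_mem] at hω
  exact hω

theorem ae_eventually_notMem_longEdge (hb : 2 ≤ b) {f : ℕ → ℝ≥0} (hf : Monotone f)
    (hlog : (fun l : ℕ => (f l : ℝ)) =o[atTop] (fun l : ℕ => Real.log (l : ℝ))) (lam : ℝ≥0) :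
    ∀ᵐ ω ∂percLaw (zoomWeight b f) lam, ∀ᶠ j in atTop, ω ∉ longEdge b (j ^ 2) ((j + 1) ^ 2) := by
  have hb' : (2 : ℝ≥0) ≤ b := by exact_mod_cast hb
  -- A crude linear bound on f suffices here, since the gaps give geometric decay.
  obtain ⟨C, hC⟩ : ∃ C : ℝ≥0, ∀ k : ℕ, 1 ≤ k → f k ≤ C * k := by
    obtain ⟨K, hK⟩ := eventually_atTop.1 (hlog.bound one_pos)
    refine ⟨1 + f K, fun k hk => ?_⟩
    have hk' : (1 : ℝ≥0) ≤ k := by exact_mod_cast hk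
    rcases le_total K k with h | h
    · have h1 := hK k h
      have hl : 0 ≤ Real.log (k : ℝ) := Real.log_nonneg (by exact_mod_cast hk)
      rw [Real.norm_of_nonneg (NNReal.coe_nonneg _), Real.norm_of_nonneg hl, one_mul] at h1
      have h2 : (f k : ℝ) ≤ k :=
        h1.trans ((Real.log_le_sub_one_of_pos (by positivity)).trans (by linarith))
      have h3 : f k ≤ k := by exact_mod_cast h2
      refine h3.trans (le_mul_of_one_le_left zero_le (by simp))
    · refine (hf h).trans ?_
      calc f K ≤ 1 + f K := by simp
        _ ≤ _ := le_mul_of_one_le_right zero_le hk'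
  have hu : Summable fun j : ℕ => ((j : ℝ≥0) + 1) ^ 2 * (2⁻¹) ^ j := by
    rw [← NNReal.summable_coe]
    have h := summable_pow_mul_geometric_of_norm_lt_one 2 (r := (2⁻¹ : ℝ)) (by norm_num)
    have h2 := ((summable_nat_add_iff 1).2 h).mul_left 2
    refine h2.congr fun j => ?_
    push_cast
    rw [pow_succ]; ring
  have hv : Summable fun j : ℕ => ((j : ℝ≥0) + 1) * (2⁻¹) ^ j := by
    refine NNReal.summable_of_le (fun j => ?_) hu
    gcongr
    exact le_self_pow₀ (by simp) (by norm_num)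
  refine ae_eventually_notMem (ne_top_of_le_ne_top (b := ∑' j : ℕ, ∑' i : ℕ,
    ((2 * lam * C : ℝ≥0) : ℝ≥0∞) * ((((j : ℝ≥0) + 1) ^ 2 * (2⁻¹) ^ j : ℝ≥0) : ℝ≥0∞) *
      ((((i : ℝ≥0) + 1) * (2⁻¹) ^ i : ℝ≥0) : ℝ≥0∞)) ?_ ?_)
  · simp_rw [ENNReal.tsum_mul_left, ENNReal.tsum_mul_right, ENNReal.tsum_mul_left]
    exact ENNReal.mul_ne_top (ENNReal.mul_ne_top ENNReal.coe_ne_top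
      (ENNReal.tsum_coe_ne_top_iff_summable.2 hu)) (ENNReal.tsum_coe_ne_top_iff_summable.2 hv)
  · refine ENNReal.tsum_le_tsum fun j =>
      (percLaw_longEdge_le f lam (Nat.pow_le_pow_left j.le_succ 2)).trans (ENNReal.tsum_le_tsum fun i => ?_)
    rw [← ENNReal.coe_mul, ← ENNReal.coe_mul, ENNReal.coe_le_coe]
    have h1 : (b : ℝ≥0) ^ j ^ 2 * ((b : ℝ≥0) ^ ((j + 1) ^ 2 + i + 1))⁻¹ ≤ 2⁻¹ ^ j * 2⁻¹ ^ i := by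
      have hb0 : (b : ℝ≥0) ≠ 0 := by positivity
      -- The gap between squares leaves b^{-(2j+i+2)}, which decays geometrically in j and in i.
      have e : (j + 1) ^ 2 + i + 1 = j ^ 2 + (j + i + (j + 2)) := by ring
      rw [e, pow_add _ (j ^ 2), mul_inv, mul_inv_cancel_left₀ (by positivity), ← pow_add, ← inv_pow]
      calc ((b : ℝ≥0)⁻¹) ^ (j + i + (j + 2)) ≤ (2⁻¹) ^ (j + i + (j + 2)) := by gcongr
        _ ≤ _ := pow_le_pow_of_le_one zero_le (by norm_num) (by omega)
    have h2 : f ((j + 1) ^ 2 + i + 1) ≤ C * (2 * (((j : ℝ≥0) + 1) ^ 2 * ((i : ℝ≥0) + 1))) := by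
      refine (hC _ (by omega)).trans ?_
      gcongr
      have : (j + 1) ^ 2 + i + 1 ≤ 2 * ((j + 1) ^ 2 * (i + 1)) := by
        have : 1 ≤ (j + 1) ^ 2 := Nat.one_le_pow _ _ (by omega)
        nlinarith
      exact_mod_cast this
    calc _ ≤ lam * ((2⁻¹ ^ j * 2⁻¹ ^ i) * (C * (2 * (((j : ℝ≥0) + 1) ^ 2 * ((i : ℝ≥0) + 1))))) := by
          gcongr
      _ = _ := by ring

/-- A vertex set without outgoing edges contains the component of each of its vertices. -/
theorem supp_subset_of_closed {V : Type*} {ω : Sym2 V → ℕ} {S : Set V}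
    (hS : ∀ x ∈ S, ∀ y ∉ S, ω s(x, y) = 0) {v : V} (hv : v ∈ S) :
    ((graphOf ω).connectedComponentMk v).supp ⊆ S := by
  intro w hw
  rw [SimpleGraph.ConnectedComponent.mem_supp_iff, SimpleGraph.ConnectedComponent.eq] at hw
  obtain ⟨p⟩ := hw.symm
  clear hw
  induction p with
  | nil => exact hv
  | cons h p ih =>
    refine ih ?_
    by_contra hn
    exact h.2.ne' (hS _ hv _ hn)

theorem percLaw_infiniteComponent_eq_zero (hb : 2 ≤ b) {f : ℕ → ℝ≥0} (hf : Monotone f)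
    (hlog : (fun l : ℕ => (f l : ℝ)) =o[atTop] (fun l : ℕ => Real.log (l : ℝ))) (lam : ℝ≥0) :
    percLaw (zoomWeight b f) lam (infiniteComponent (SumZ b)) = 0 := by
  suffices ∀ᵐ ω ∂percLaw (zoomWeight b f) lam, ω ∉ infiniteComponent (SumZ b) by
    simpa [ae_iff] using this
  filter_upwards [ae_frequently_annulusEdges_eq_zero hb hf hlog lam,
    ae_eventually_notMem_longEdge hb hf hlog lam] with ω h1 h2
  rintro ⟨C, hC⟩
  obtain ⟨v, rfl⟩ := C.exists_rep
  -- No long edge may start in the ball of radius j^2 or in that of radius (j+1)^2; with the empty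
  -- annulus j this seals the latter ball. The last condition puts v inside it.
  obtain ⟨j, hj1, hj2, hj3, hj4⟩ := (h1.and_eventually (h2.and
    (((tendsto_add_atTop_nat 1).eventually h2).and (eventually_ge_atTop (lastPos v))))).exists
  refine hC ((ball (0 : SumZ b) ((j + 1) ^ 2)).finite_toSet.subset
    (supp_subset_of_closed (fun x hx y hy => ?_) ?_))
  · by_contra hne
    rw [Finset.mem_coe] at hx hy
    by_cases hy2 : y ∈ ball (0 : SumZ b) ((j + 1 + 1) ^ 2)
    · by_cases hx2 : x ∈ ball (0 : SumZ b) (j ^ 2)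
      · exact hj2 ⟨x, hx2, y, hy, hne⟩
      · exact hne (hj1 _ (mem_annulusEdges.2 ⟨x, Finset.mem_sdiff.2 ⟨hx, hx2⟩, y,
          Finset.mem_sdiff.2 ⟨hy2, hy⟩, rfl⟩))
    · exact hj3 ⟨x, hx, y, hy2, hne⟩
  · exact ball_mono 0 (by nlinarith) (mem_ball_zero_lastPos v)

theorem lambdaC_eq_top (hb : 2 ≤ b) {f : ℕ → ℝ≥0} (hf : Monotone f)
    (hlog : (fun l : ℕ => (f l : ℝ)) =o[atTop] (fun l : ℕ => Real.log (l : ℝ))) :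
    lambdaC (zoomWeight b f) = ⊤ := by
  refine ENNReal.eq_top_of_forall_nnreal_le fun lam => ?_
  exact le_iSup₂_of_le lam (percLaw_infiniteComponent_eq_zero hb hf hlog lam) le_rfl

end Subcritical

/-! ### Hierarchical clusters: deterministic properties. -/

section Clusters

variable {b : ℕ} [NeZero b]

/-- The union of the sets `K y` over the points `y` of the ball of radius `m` around `x`. -/
noncomputable def ballUnion (K : SumZ b → Finset (SumZ b)) (x : SumZ b) (m : ℕ) :
    Finset (SumZ b) :=
  open Classical in (ball x m).biUnion K

theorem mem_ballUnion {K : SumZ b → Finset (SumZ b)} {x u : SumZ b} {m : ℕ} :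
    u ∈ ballUnion K x m ↔ ∃ y ∈ ball x m, u ∈ K y := by
  simp [ballUnion]

/-- The set `U` if it has at least `k` points and spans a connected subgraph, and `∅` otherwise. -/
noncomputable def retain {V : Type*} (ω : Sym2 V → ℕ) (k : ℕ) (U : Finset V) : Finset V :=
  open Classical in
  if k ≤ U.card ∧ ((graphOf ω).induce (U : Set V)).Preconnected then U else ∅

/-- The hierarchical clusters. The cluster of a ball of radius `l (n + 1)` is the union of the
clusters of its subballs of radius `l n`, if that union has at least `s (n + 1)` points and is
connected, and is empty otherwise. -/
noncomputable def cluster (l s : ℕ → ℕ) (ω : Sym2 (SumZ b) → ℕ) : ℕ → SumZ b → Finset (SumZ b)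
  | 0, x => {x.filter (l 0 ≤ ·)}
  | n + 1, x => retain ω (s (n + 1)) (ballUnion (cluster l s ω n) x (l (n + 1)))

variable {l s : ℕ → ℕ} {ω : Sym2 (SumZ b) → ℕ}

theorem cluster_succ_of_ne {n : ℕ} {x : SumZ b} (h : cluster l s ω (n + 1) x ≠ ∅) :
    cluster l s ω (n + 1) x = ballUnion (cluster l s ω n) x (l (n + 1)) ∧
      s (n + 1) ≤ (ballUnion (cluster l s ω n) x (l (n + 1))).card ∧
        ((graphOf ω).induce
          (ballUnion (cluster l s ω n) x (l (n + 1)) : Set (SumZ b))).Preconnected := by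
  rw [cluster, retain] at h ⊢
  split_ifs at h ⊢ with h1
  · exact ⟨rfl, h1⟩
  · exact absurd rfl h

theorem cluster_eq_of_mem_ball {n : ℕ} {x y : SumZ b} (h : y ∈ ball x (l n)) :
    cluster l s ω n y = cluster l s ω n x := by
  cases n with
  | zero =>
    simp only [cluster, Finset.singleton_inj]
    ext i
    rw [Finsupp.filter_apply, Finsupp.filter_apply]
    split_ifs with hi
    · exact mem_ball.1 h i hi
    · rfl
  | succ n => simp only [cluster, ballUnion, ball_eq h]

theorem cluster_subset_ball (hl : Monotone l) (n : ℕ) (x : SumZ b) :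
    cluster l s ω n x ⊆ ball x (l n) := by
  induction n generalizing x with
  | zero =>
    intro y hy
    rw [cluster, Finset.mem_singleton] at hy
    subst hy
    exact mem_ball.2 fun i hi => by rw [Finsupp.filter_apply, if_pos hi]
  | succ n ih =>
    intro u hu
    have h := cluster_succ_of_ne (Finset.ne_empty_of_mem hu)
    rw [h.1, mem_ballUnion] at hu
    obtain ⟨y, hy, hu⟩ := hu
    rw [← ball_eq hy]
    exact ball_mono y (hl n.le_succ) (ih y hu)

theorem le_card_cluster (hs : s 0 ≤ 1) {n : ℕ} {x : SumZ b} (h : cluster l s ω n x ≠ ∅) :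
    s n ≤ (cluster l s ω n x).card := by
  cases n with
  | zero => simpa [cluster] using hs
  | succ n => rw [(cluster_succ_of_ne h).1]; exact (cluster_succ_of_ne h).2.1

theorem preconnected_cluster (n : ℕ) (x : SumZ b) :
    ((graphOf ω).induce (cluster l s ω n x : Set (SumZ b))).Preconnected := by
  by_cases h : cluster l s ω n x = ∅
  · rw [h]
    intro u
    exact absurd u.2 (by simp)
  · cases n with
    | zero =>
      rintro ⟨u, hu⟩ ⟨v, hv⟩
      simp only [cluster, Finset.coe_singleton, Set.mem_singleton_iff] at hu hv
      subst hu hv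
      rfl
    | succ n => rw [(cluster_succ_of_ne h).1]; exact (cluster_succ_of_ne h).2.2

theorem cluster_subset_succ {n : ℕ} {x : SumZ b} (h : cluster l s ω (n + 1) x ≠ ∅) :
    cluster l s ω n x ⊆ cluster l s ω (n + 1) x := by
  rw [(cluster_succ_of_ne h).1]
  exact fun u hu => mem_ballUnion.2 ⟨x, self_mem_ball _ _, hu⟩

/-- Locality: a cluster is determined by the edges inside its ball. Independence of clusters in
disjoint balls, and of the edges between them, rests on this. -/
theorem cluster_congr (hl : Monotone l) {ω' : Sym2 (SumZ b) → ℕ} (n : ℕ) (x : SumZ b)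
    (h : ∀ e ∈ (ball x (l n)).sym2, ω e = ω' e) :
    cluster l s ω n x = cluster l s ω' n x := by
  induction n generalizing x with
  | zero => rfl
  | succ n ih =>
    have hsub : ∀ y ∈ ball x (l (n + 1)), ball y (l n) ⊆ ball x (l (n + 1)) := fun y hy => by
      rw [← ball_eq hy]; exact ball_mono y (hl n.le_succ)
    have hU : ballUnion (cluster l s ω n) x (l (n + 1)) =
        ballUnion (cluster l s ω' n) x (l (n + 1)) := by
      ext u
      simp only [mem_ballUnion]
      refine exists_congr fun y => and_congr_right fun hy => ?_
      rw [ih y fun e he => h e (Finset.sym2_mono (hsub y hy) he)]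
    have hG : (graphOf ω).induce (ballUnion (cluster l s ω' n) x (l (n + 1)) : Set (SumZ b)) =
        (graphOf ω').induce (ballUnion (cluster l s ω' n) x (l (n + 1)) : Set (SumZ b)) := by
      have hm : ∀ u ∈ ballUnion (cluster l s ω' n) x (l (n + 1)), u ∈ ball x (l (n + 1)) := by
        intro u hu
        obtain ⟨y, hy, hu⟩ := mem_ballUnion.1 hu
        exact hsub y hy (cluster_subset_ball hl n y hu)
      ext ⟨u, hu⟩ ⟨v, hv⟩
      simp only [SimpleGraph.comap_adj, graphOf, Function.Embedding.subtype_apply]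
      rw [h s(u, v) (Finset.mk_mem_sym2_iff.2 ⟨hm u hu, hm v hv⟩)]
    rw [cluster, cluster, hU, retain, retain]
    congr 1
    rw [hG]

/-- One point from each of the balls of radius `l` inside the ball of radius `m` around `x`. -/
noncomputable def centers (x : SumZ b) (l m : ℕ) : Finset (SumZ b) :=
  block (Finset.Ico l m) (x.filter (m ≤ ·))

theorem card_centers (x : SumZ b) (l m : ℕ) : (centers x l m).card = b ^ (m - l) := by
  rw [centers, card_block, Nat.card_Ico]

theorem mem_centers {x y : SumZ b} {l m : ℕ} (hlm : l ≤ m) :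
    y ∈ centers x l m ↔ y ∈ ball x m ∧ ∀ i < l, y i = 0 := by
  rw [centers, mem_block, mem_ball]
  constructor
  · intro h
    refine ⟨fun i hi => ?_, fun i hi => ?_⟩
    · rw [h i (by simp; omega), Finsupp.filter_apply, if_pos hi]
    · rw [h i (by simp; omega), Finsupp.filter_apply, if_neg (by omega)]
  · rintro ⟨h1, h2⟩ i hi
    rw [Finsupp.filter_apply]
    split_ifs with him
    · exact h1 i him
    · exact h2 i (by simp at hi; omega)

theorem eq_of_mem_centers {x y z : SumZ b} {l m : ℕ} (hlm : l ≤ m) (hy : y ∈ centers x l m)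
    (hz : z ∈ centers x l m) (h : z ∈ ball y l) : z = y := by
  rw [mem_centers hlm] at hy hz
  ext i
  by_cases hi : i < l
  · rw [hy.2 i hi, hz.2 i hi]
  · exact mem_ball.1 h i (by omega)

theorem exists_mem_centers {x u : SumZ b} {l m : ℕ} (hlm : l ≤ m) (hu : u ∈ ball x m) :
    ∃ y ∈ centers x l m, u ∈ ball y l := by
  refine ⟨u.filter (l ≤ ·), (mem_centers hlm).2 ⟨mem_ball.2 fun i hi => ?_, fun i hi => ?_⟩,
    mem_ball.2 fun i hi => ?_⟩
  · rw [Finsupp.filter_apply, if_pos (hlm.trans hi), mem_ball.1 hu i hi]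
  · rw [Finsupp.filter_apply, if_neg (by omega)]
  · rw [Finsupp.filter_apply, if_pos hi]

theorem disjoint_ball_of_notMem {y z : SumZ b} {l : ℕ} (h : z ∉ ball y l) :
    Disjoint (ball y l) (ball z l) :=
  Finset.disjoint_left.2 fun u hu hu' => h (by
    rw [← ball_eq hu, ball_eq hu']; exact self_mem_ball z l)

theorem le_card_ballUnion (hl : Monotone l) (hs : s 0 ≤ 1) {n : ℕ} {x : SumZ b}
    (h : ∀ y ∈ centers x (l n) (l (n + 1)), ∀ z ∈ centers x (l n) (l (n + 1)),
      cluster l s ω n y = ∅ → cluster l s ω n z = ∅ → y = z) :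
    (b ^ (l (n + 1) - l n) - 1) * s n ≤
      (ballUnion (cluster l s ω n) x (l (n + 1))).card := by
  classical
  have hlm := hl n.le_succ
  set C := centers x (l n) (l (n + 1)) with hC
  set C' := C.filter fun y => ¬ cluster l s ω n y = ∅ with hC'
  have h1 : b ^ (l (n + 1) - l n) - 1 ≤ C'.card := by
    have h2 : (C.filter fun y => cluster l s ω n y = ∅).card ≤ 1 :=
      Finset.card_le_one.2 fun y hy z hz =>
        h y (Finset.mem_filter.1 hy).1 z (Finset.mem_filter.1 hz).1 (Finset.mem_filter.1 hy).2
          (Finset.mem_filter.1 hz).2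
    have h3 : (C.filter fun y => cluster l s ω n y = ∅).card + C'.card = C.card := by
      convert! Finset.card_filter_add_card_filter_not (s := C) fun y => cluster l s ω n y = ∅
    rw [hC, card_centers, ← hC] at h3
    omega
  have h4 : C'.biUnion (cluster l s ω n) ⊆ ballUnion (cluster l s ω n) x (l (n + 1)) := by
    intro u hu
    obtain ⟨y, hy, hu⟩ := Finset.mem_biUnion.1 hu
    exact mem_ballUnion.2 ⟨y, ((mem_centers hlm).1 (Finset.mem_filter.1 hy).1).1, hu⟩
  refine le_trans ?_ (Finset.card_le_card h4)
  rw [Finset.card_biUnion]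
  · calc _ ≤ C'.card * s n := Nat.mul_le_mul_right _ h1
      _ ≤ _ := by
        rw [← smul_eq_mul]
        exact Finset.card_nsmul_le_sum _ _ _ fun y hy =>
          le_card_cluster hs (Finset.mem_filter.1 hy).2
  · intro y hy z hz hyz
    refine (disjoint_ball_of_notMem (l := l n) fun hm => hyz ?_).mono (cluster_subset_ball hl n y)
      (cluster_subset_ball hl n z)
    exact (eq_of_mem_centers hlm (Finset.mem_filter.1 hy).1 (Finset.mem_filter.1 hz).1 hm).symm

theorem preconnected_ballUnion (hl : Monotone l) {n : ℕ} {x : SumZ b}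
    (h : ∀ y ∈ centers x (l n) (l (n + 1)), ∀ z ∈ centers x (l n) (l (n + 1)), y ≠ z →
      cluster l s ω n y ≠ ∅ → cluster l s ω n z ≠ ∅ →
      ∃ u ∈ cluster l s ω n y, ∃ v ∈ cluster l s ω n z, ω s(u, v) ≠ 0) :
    ((graphOf ω).induce
      (ballUnion (cluster l s ω n) x (l (n + 1)) : Set (SumZ b))).Preconnected := by
  have hlm := hl n.le_succ
  set U := ballUnion (cluster l s ω n) x (l (n + 1)) with hU
  have hsub : ∀ y ∈ centers x (l n) (l (n + 1)), (cluster l s ω n y : Set (SumZ b)) ⊆ U :=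
    fun y hy u hu => mem_ballUnion.2 ⟨y, ((mem_centers hlm).1 hy).1, hu⟩
  have hin : ∀ u ∈ U, ∃ y ∈ centers x (l n) (l (n + 1)), u ∈ cluster l s ω n y := by
    intro u hu
    obtain ⟨w, hw, hu⟩ := mem_ballUnion.1 hu
    obtain ⟨y, hy, hwy⟩ := exists_mem_centers hlm hw
    exact ⟨y, hy, cluster_eq_of_mem_ball hwy ▸ hu⟩
  have hloc : ∀ y (hy : y ∈ centers x (l n) (l (n + 1))) u (hu : u ∈ cluster l s ω n y) v
      (hv : v ∈ cluster l s ω n y), ((graphOf ω).induce (U : Set (SumZ b))).Reachable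
        ⟨u, hsub y hy hu⟩ ⟨v, hsub y hy hv⟩ := fun y hy u hu v hv =>
    (preconnected_cluster n y ⟨u, hu⟩ ⟨v, hv⟩).map
      (SimpleGraph.induceHomOfLE (graphOf ω) (hsub y hy)).toHom
  rintro ⟨u, hu⟩ ⟨v, hv⟩
  obtain ⟨y, hy, huy⟩ := hin u hu
  obtain ⟨z, hz, hvz⟩ := hin v hv
  by_cases hyz : y = z
  · subst hyz
    exact hloc y hy u huy v hvz
  · obtain ⟨u', hu', v', hv', hne⟩ :=
      h y hy z hz hyz (Finset.ne_empty_of_mem huy) (Finset.ne_empty_of_mem hvz)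
    have huv : u' ≠ v' := by
      rintro rfl
      exact Finset.disjoint_left.1 (disjoint_ball_of_notMem (l := l n)
        fun hm => hyz (eq_of_mem_centers hlm hy hz hm).symm) (cluster_subset_ball hl n y hu')
        (cluster_subset_ball hl n z hv')
    have hadj : ((graphOf ω).induce (U : Set (SumZ b))).Adj ⟨u', hsub y hy hu'⟩
        ⟨v', hsub z hz hv'⟩ := ⟨huv, Nat.pos_of_ne_zero hne⟩
    exact (hloc y hy u huy u' hu').trans (hadj.reachable.trans (hloc z hz v' hv' v hvz))

/-- If every pair of subballs behaves, at most one subcluster is empty, so the union is large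
enough, and the nonempty ones are pairwise joined, so it is connected. Stating failure through pairs
prepares a union bound. -/
theorem cluster_succ_eq_empty (hl : Monotone l) (hs : s 0 ≤ 1) {n : ℕ}
    (hs1 : 0 < s (n + 1)) (hs2 : s (n + 1) ≤ (b ^ (l (n + 1) - l n) - 1) * s n) {x : SumZ b}
    (h : cluster l s ω (n + 1) x = ∅) :
    ∃ y ∈ centers x (l n) (l (n + 1)), ∃ z ∈ centers x (l n) (l (n + 1)), y ≠ z ∧
      ((cluster l s ω n y = ∅ ∧ cluster l s ω n z = ∅) ∨
        (cluster l s ω n y ≠ ∅ ∧ cluster l s ω n z ≠ ∅ ∧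
          ∀ u ∈ cluster l s ω n y, ∀ v ∈ cluster l s ω n z, ω s(u, v) = 0)) := by
  by_contra hcon
  push Not at hcon
  have h1 : s (n + 1) ≤ (ballUnion (cluster l s ω n) x (l (n + 1))).card :=
    hs2.trans (le_card_ballUnion hl hs fun y hy z hz hy0 hz0 => by
      by_contra hyz
      exact ((hcon y hy z hz hyz).1 hy0).ne_empty hz0)
  have h2 : ((graphOf ω).induce
      (ballUnion (cluster l s ω n) x (l (n + 1)) : Set (SumZ b))).Preconnected :=
    preconnected_ballUnion hl fun y hy z hz hyz hy0 hz0 => by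
      have := (hcon y hy z hz hyz).2
      simp only [← Finset.nonempty_iff_ne_empty] at this hy0 hz0
      exact this hy0 hz0
  rw [cluster, retain, if_pos ⟨h1, h2⟩] at h
  rw [h, Finset.card_empty] at h1
  omega

end Clusters

/-! ### Probability that a cluster fails. -/

section ClusterLaw

variable {b : ℕ} [NeZero b] {l s : ℕ → ℕ} {f : ℕ → ℝ≥0} {lam : ℝ≥0}

theorem dependsOn_cluster_mem (hl : Monotone l) (n : ℕ) (y : SumZ b)
    (P : Finset (SumZ b) → Prop) :
    DependsOn (· ∈ {ω : Sym2 (SumZ b) → ℕ | P (cluster l s ω n y)})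
      ((ball y (l n)).sym2 : Set (Sym2 (SumZ b))) := fun ω ω' h => by
  change P (cluster l s ω n y) = P (cluster l s ω' n y)
  rw [cluster_congr hl n y h]

theorem disjoint_sym2_ball {y z : SumZ b} {m : ℕ} (h : z ∉ ball y m) :
    Disjoint (ball y m).sym2 (ball z m).sym2 := by
  refine Finset.disjoint_left.2 fun e => ?_
  induction e with
  | h u v =>
    intro h1 h2
    exact Finset.disjoint_left.1 (disjoint_ball_of_notMem h) (Finset.mk_mem_sym2_iff.1 h1).1
      (Finset.mk_mem_sym2_iff.1 h2).1

/-- Each of the at least k^2 pairs is at distance above m and at most m', so monotonicity of f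
bounds its weight below by b^{-2m'} f(m). -/
theorem percLaw_no_edge_le (hf : Monotone f) {m m' : ℕ} {y z : SumZ b} (hmm : m ≤ m')
    (hz : z ∉ ball y m) (hz' : z ∈ ball y m') {A B : Finset (SumZ b)} (hA : A ⊆ ball y m)
    (hB : B ⊆ ball z m) {k : ℕ} (hkA : k ≤ A.card) (hkB : k ≤ B.card) (E : Finset (Sym2 (SumZ b)))
    (hE : ∀ u ∈ A, ∀ v ∈ B, s(u, v) ∈ E) :
    percLaw (zoomWeight b f) lam {ω | ∀ e ∈ E, ω e = 0} ≤
      ENNReal.ofReal (Real.exp (-(lam * ((k : ℝ) ^ 2 * ((b : ℝ) ^ (2 * m'))⁻¹ * f m)))) := by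
  classical
  have hdis := disjoint_ball_of_notMem hz
  rw [percLaw_forall_eq_zero]
  refine ENNReal.ofReal_le_ofReal (Real.exp_le_exp.2 (neg_le_neg ?_))
  have hinj : Set.InjOn (fun p : SumZ b × SumZ b => s(p.1, p.2))
      (A ×ˢ B : Finset (SumZ b × SumZ b)) := by
    rintro ⟨u, v⟩ h1 ⟨u', v'⟩ h2 h
    rw [Finset.mem_coe, Finset.mem_product] at h1 h2
    rcases Sym2.eq_iff.1 h with ⟨h3, h4⟩ | ⟨h3, h4⟩
    · exact Prod.ext h3 h4
    · exact absurd (hB h2.2) (Finset.disjoint_left.1 hdis (h3 ▸ hA h1.1))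
  calc (lam : ℝ) * ((k : ℝ) ^ 2 * ((b : ℝ) ^ (2 * m'))⁻¹ * f m)
      ≤ lam * (((A.card : ℝ) * B.card) * ((b : ℝ) ^ (2 * m'))⁻¹ * f m) := by
        have h1 : (k : ℝ) ≤ A.card := by exact_mod_cast hkA
        have h2 : (k : ℝ) ≤ B.card := by exact_mod_cast hkB
        rw [sq]
        gcongr
    _ = (A ×ˢ B).card • ((lam : ℝ) * (((b : ℝ) ^ (2 * m'))⁻¹ * f m)) := by
        rw [nsmul_eq_mul, Finset.card_product]; push_cast; ring
    _ ≤ ∑ p ∈ A ×ˢ B, (edgeRate (zoomWeight b f) lam s(p.1, p.2) : ℝ) := by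
        refine Finset.card_nsmul_le_sum _ _ _ fun p hp => ?_
        rw [Finset.mem_product] at hp
        have hu := hA hp.1
        have hv := hB hp.2
        rw [edgeRate_mk, NNReal.coe_mul]
        refine mul_le_mul_of_nonneg_left ?_ lam.coe_nonneg
        have h1 : p.2 ∉ ball p.1 m := by
          rw [ball_eq hu]; exact fun h => Finset.disjoint_left.1 hdis h hv
        have h2 : p.2 ∈ ball p.1 m' := by
          rw [ball_eq (ball_mono y hmm hu), ← ball_eq hz']; exact ball_mono z hmm hv
        rw [mem_ball_iff_lastPos] at h1 h2
        exact_mod_cast zoomWeight_wt_le hf (by omega) h2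
    _ = ∑ e ∈ (A ×ˢ B).image fun p => s(p.1, p.2), (edgeRate (zoomWeight b f) lam e : ℝ) :=
        (Finset.sum_image (f := fun e => (edgeRate (zoomWeight b f) lam e : ℝ)) hinj).symm
    _ ≤ _ := by
        refine Finset.sum_le_sum_of_subset_of_nonneg (fun e he => ?_)
          fun _ _ _ => NNReal.coe_nonneg _
        obtain ⟨p, hp, rfl⟩ := Finset.mem_image.1 he
        rw [Finset.mem_product] at hp
        exact hE _ hp.1 _ hp.2

/-- Split according to the values of the two clusters. These depend on edges inside the two balls,
whereas the joining edges run between the balls, so for each value the bound on absent edges factors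
out; the values are disjoint events. -/
theorem percLaw_clusters_not_joined_le (hf : Monotone f) (hl : Monotone l) (hs : s 0 ≤ 1) {n : ℕ}
    {y z : SumZ b} (hz : z ∉ ball y (l n)) (hz' : z ∈ ball y (l (n + 1))) :
    percLaw (zoomWeight b f) lam {ω | cluster l s ω n y ≠ ∅ ∧ cluster l s ω n z ≠ ∅ ∧
        ∀ u ∈ cluster l s ω n y, ∀ v ∈ cluster l s ω n z, ω s(u, v) = 0} ≤
      ENNReal.ofReal (Real.exp
        (-(lam * ((s n : ℝ) ^ 2 * ((b : ℝ) ^ (2 * l (n + 1)))⁻¹ * f (l n))))) := by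
  classical
  have hdis := disjoint_ball_of_notMem hz
  set q := ENNReal.ofReal (Real.exp
    (-(lam * ((s n : ℝ) ^ 2 * ((b : ℝ) ^ (2 * l (n + 1)))⁻¹ * f (l n))))) with hq
  set I := ((ball y (l n)).powerset ×ˢ (ball z (l n)).powerset).filter
    fun p => s n ≤ p.1.card ∧ s n ≤ p.2.card with hI
  set E : Finset (SumZ b) × Finset (SumZ b) → Finset (Sym2 (SumZ b)) := fun p =>
    (p.1 ×ˢ p.2).image fun p => s(p.1, p.2) with hE
  set ev : Finset (SumZ b) × Finset (SumZ b) → Set (Sym2 (SumZ b) → ℕ) := fun p =>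
    {ω | cluster l s ω n y = p.1} ∩ {ω | cluster l s ω n z = p.2} with hev
  set T := (ball y (l n)).sym2 ∪ (ball z (l n)).sym2 with hT
  have hdep : ∀ p, DependsOn (· ∈ ev p) (T : Set (Sym2 (SumZ b))) := fun p ω ω' h => by
    have h1 := dependsOn_cluster_mem (s := s) hl n y (· = p.1)
      (fun e he => h e (by rw [hT, Finset.coe_union]; exact Or.inl he))
    have h2 := dependsOn_cluster_mem (s := s) hl n z (· = p.2)
      (fun e he => h e (by rw [hT, Finset.coe_union]; exact Or.inr he))
    exact congrArg₂ And h1 h2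
  have hsub : {ω | cluster l s ω n y ≠ ∅ ∧ cluster l s ω n z ≠ ∅ ∧
        ∀ u ∈ cluster l s ω n y, ∀ v ∈ cluster l s ω n z, ω s(u, v) = 0} ⊆
      ⋃ p ∈ I, ev p ∩ {ω | ∀ e ∈ E p, ω e = 0} := by
    rintro ω ⟨h1, h2, h3⟩
    simp only [Set.mem_iUnion]
    refine ⟨(cluster l s ω n y, cluster l s ω n z), ?_, ⟨rfl, rfl⟩, fun e he => ?_⟩
    · simp only [hI, Finset.mem_filter, Finset.mem_product, Finset.mem_powerset]
      exact ⟨⟨cluster_subset_ball hl n y, cluster_subset_ball hl n z⟩, le_card_cluster hs h1,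
        le_card_cluster hs h2⟩
    · obtain ⟨p, hp, rfl⟩ := Finset.mem_image.1 he
      rw [Finset.mem_product] at hp
      exact h3 _ hp.1 _ hp.2
  have hterm : ∀ p ∈ I, percLaw (zoomWeight b f) lam (ev p ∩ {ω | ∀ e ∈ E p, ω e = 0}) ≤
      percLaw (zoomWeight b f) lam (ev p) * q := by
    intro p hp
    simp only [hI, Finset.mem_filter, Finset.mem_product, Finset.mem_powerset] at hp
    obtain ⟨⟨hA, hB⟩, hkA, hkB⟩ := hp
    have hdepE : DependsOn (· ∈ {ω : Sym2 (SumZ b) → ℕ | ∀ e ∈ E p, ω e = 0})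
        (E p : Set (Sym2 (SumZ b))) := fun ω ω' h =>
      propext (forall₂_congr fun e he => by rw [h e he])
    rw [percLaw_inter_of_dependsOn (T₁ := T) (T₂ := E p) _ _ ?_ (hdep p) hdepE]
    · gcongr
      exact percLaw_no_edge_le hf (hl n.le_succ) hz hz' hA hB hkA hkB _ fun u hu v hv =>
        Finset.mem_image.2 ⟨(u, v), Finset.mem_product.2 ⟨hu, hv⟩, rfl⟩
    · refine Finset.disjoint_left.2 fun e h1 h2 => ?_
      obtain ⟨w, hw, rfl⟩ := Finset.mem_image.1 h2
      rw [Finset.mem_product] at hw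
      rw [hT, Finset.mem_union, Finset.mk_mem_sym2_iff, Finset.mk_mem_sym2_iff] at h1
      rcases h1 with h1 | h1
      · exact Finset.disjoint_left.1 hdis h1.2 (hB hw.2)
      · exact Finset.disjoint_left.1 hdis (hA hw.1) h1.1
  calc _ ≤ ∑ p ∈ I, percLaw (zoomWeight b f) lam (ev p ∩ {ω | ∀ e ∈ E p, ω e = 0}) :=
        (measure_mono hsub).trans (measure_biUnion_finset_le _ _)
    _ ≤ ∑ p ∈ I, percLaw (zoomWeight b f) lam (ev p) * q := Finset.sum_le_sum hterm
    _ = percLaw (zoomWeight b f) lam (⋃ p ∈ I, ev p) * q := by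
        rw [← Finset.sum_mul, measure_biUnion_finset]
        · intro p _ p' _ hpp
          refine Set.disjoint_left.2 fun ω h1 h2 => hpp ?_
          exact Prod.ext (h1.1.symm.trans h2.1) (h1.2.symm.trans h2.2)
        · exact fun p _ => measurableSet_of_dependsOn (hdep p)
    _ ≤ 1 * q := by gcongr; exact prob_le_one
    _ = q := one_mul q

/-- The square of p comes from independence of clusters in distinct subballs; the prefactor counts
ordered pairs of subballs. -/
theorem percLaw_cluster_succ_eq_empty_le (hf : Monotone f) (hl : Monotone l) (hs : s 0 ≤ 1)
    {n : ℕ} (hs1 : 0 < s (n + 1)) (hs2 : s (n + 1) ≤ (b ^ (l (n + 1) - l n) - 1) * s n)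
    {p : ℝ≥0∞} (hp : ∀ x : SumZ b, percLaw (zoomWeight b f) lam {ω | cluster l s ω n x = ∅} ≤ p)
    (x : SumZ b) :
    percLaw (zoomWeight b f) lam {ω | cluster l s ω (n + 1) x = ∅} ≤
      (b : ℝ≥0∞) ^ (2 * (l (n + 1) - l n)) * (p ^ 2 + ENNReal.ofReal (Real.exp
        (-(lam * ((s n : ℝ) ^ 2 * ((b : ℝ) ^ (2 * l (n + 1)))⁻¹ * f (l n)))))) := by
  classical
  have hlm := hl n.le_succ
  set q := ENNReal.ofReal (Real.exp
    (-(lam * ((s n : ℝ) ^ 2 * ((b : ℝ) ^ (2 * l (n + 1)))⁻¹ * f (l n))))) with hq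
  set C := centers x (l n) (l (n + 1)) with hC
  set J := (C ×ˢ C).filter fun w => w.1 ≠ w.2 with hJ
  set bad1 : SumZ b × SumZ b → Set (Sym2 (SumZ b) → ℕ) := fun w =>
    {ω | cluster l s ω n w.1 = ∅} ∩ {ω | cluster l s ω n w.2 = ∅}
  set bad2 : SumZ b × SumZ b → Set (Sym2 (SumZ b) → ℕ) := fun w =>
    {ω | cluster l s ω n w.1 ≠ ∅ ∧ cluster l s ω n w.2 ≠ ∅ ∧
      ∀ u ∈ cluster l s ω n w.1, ∀ v ∈ cluster l s ω n w.2, ω s(u, v) = 0}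
  have hsub : {ω | cluster l s ω (n + 1) x = ∅} ⊆ ⋃ w ∈ J, bad1 w ∪ bad2 w := by
    intro ω hω
    obtain ⟨y, hy, z, hz, hyz, h⟩ := cluster_succ_eq_empty hl hs hs1 hs2 hω
    simp only [Set.mem_iUnion]
    exact ⟨(y, z), Finset.mem_filter.2 ⟨Finset.mem_product.2 ⟨hy, hz⟩, hyz⟩, h⟩
  have hterm : ∀ w ∈ J, percLaw (zoomWeight b f) lam (bad1 w ∪ bad2 w) ≤ p ^ 2 + q := by
    rintro ⟨y, z⟩ hw
    obtain ⟨hw1, hw2⟩ := Finset.mem_filter.1 hw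
    obtain ⟨hy, hz⟩ := Finset.mem_product.1 hw1
    have hn : z ∉ ball y (l n) := fun hm => hw2 (eq_of_mem_centers hlm hy hz hm).symm
    have hm : z ∈ ball y (l (n + 1)) := by
      rw [ball_eq ((mem_centers hlm).1 hy).1]; exact ((mem_centers hlm).1 hz).1
    refine (measure_union_le _ _).trans
      (add_le_add ?_ (percLaw_clusters_not_joined_le hf hl hs hn hm))
    rw [percLaw_inter_of_dependsOn _ _ (disjoint_sym2_ball hn)
      (dependsOn_cluster_mem hl n y (· = ∅)) (dependsOn_cluster_mem hl n z (· = ∅)), sq]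
    exact mul_le_mul' (hp y) (hp z)
  refine (measure_mono hsub).trans ((measure_biUnion_finset_le _ _).trans
    ((Finset.sum_le_card_nsmul _ _ _ hterm).trans ?_))
  rw [nsmul_eq_mul]
  gcongr
  have : J.card ≤ b ^ (2 * (l (n + 1) - l n)) := by
    refine (Finset.card_filter_le _ _).trans ?_
    rw [Finset.card_product, hC, card_centers, two_mul, pow_add]
  exact_mod_cast this

/-- If no cluster of 0 is empty, they form an increasing chain of connected sets of unbounded size.
Subadditivity is all that is used, so the infinite-component event need not be measurable. -/
theorem percLaw_infiniteComponent_ne_zero (hs : s 0 ≤ 1) (hlim : Tendsto s atTop atTop)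
    (h : ∑' n, percLaw (zoomWeight b f) lam {ω | cluster l s ω n 0 = ∅} < 1) :
    percLaw (zoomWeight b f) lam (infiniteComponent (SumZ b)) ≠ 0 := by
  intro h0
  have hsub : (Set.univ : Set (Sym2 (SumZ b) → ℕ)) ⊆
      infiniteComponent (SumZ b) ∪ ⋃ n, {ω | cluster l s ω n 0 = ∅} := by
    intro ω _
    by_cases hω : ∃ n, cluster l s ω n 0 = ∅
    · exact Or.inr (Set.mem_iUnion.2 hω)
    · left
      push Not at hω
      have hne : ∀ n, cluster l s ω n 0 ≠ ∅ := fun n => (hω n).ne_empty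
      obtain ⟨o, ho⟩ := hω 0
      have hmem : ∀ n, o ∈ cluster l s ω n 0 := by
        intro n
        induction n with
        | zero => exact ho
        | succ n ih => exact cluster_subset_succ (hne _) ih
      refine ⟨(graphOf ω).connectedComponentMk o, fun hfin => ?_⟩
      obtain ⟨n, hn⟩ := (hlim.eventually_gt_atTop hfin.toFinset.card).exists
      have hle : cluster l s ω n 0 ⊆ hfin.toFinset := by
        intro u hu
        rw [Set.Finite.mem_toFinset, SimpleGraph.ConnectedComponent.mem_supp_iff,
          SimpleGraph.ConnectedComponent.eq]
        exact (preconnected_cluster n 0 ⟨u, hu⟩ ⟨o, hmem n⟩).map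
          (SimpleGraph.Embedding.induce _).toHom
      have := (le_card_cluster hs (hne n)).trans (Finset.card_le_card hle)
      omega
  have h1 := (measure_mono hsub).trans (measure_union_le (μ := percLaw (zoomWeight b f) lam) _ _)
  rw [measure_univ, h0, zero_add] at h1
  exact absurd (h1.trans (measure_iUnion_le _)) (not_le.2 h)

end ClusterLaw

/-! ### Choice of scales and percolation for large intensity. -/

section Supercritical

/-- Radii that grow by about `2 log_b (n + 2)` in the `n`-th step. -/
def levelSeq (b L n : ℕ) : ℕ := L + ∑ i ∈ Finset.range n, Nat.clog b ((i + 2) ^ 2)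

/-- The size required of a cluster when each step may lose one subball. -/
def sizeSeq (b : ℕ) : ℕ → ℕ
  | 0 => 1
  | n + 1 => (b ^ Nat.clog b ((n + 2) ^ 2) - 1) * sizeSeq b n

theorem levelSeq_succ (b L n : ℕ) :
    levelSeq b L (n + 1) = levelSeq b L n + Nat.clog b ((n + 2) ^ 2) := by
  rw [levelSeq, levelSeq, Finset.sum_range_succ, add_assoc]

theorem levelSeq_mono (b L : ℕ) : Monotone (levelSeq b L) :=
  monotone_nat_of_le_succ fun n => by rw [levelSeq_succ]; exact Nat.le_add_right _ _

variable {b : ℕ}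

theorem le_levelSeq (hb : 2 ≤ b) (L n : ℕ) : L + n ≤ levelSeq b L n := by
  induction n with
  | zero => simp [levelSeq]
  | succ n ih =>
    have : 0 < Nat.clog b ((n + 2) ^ 2) := Nat.clog_pos hb (by nlinarith)
    rw [levelSeq_succ]
    omega

theorem sq_le_pow_clog (hb : 2 ≤ b) (n : ℕ) : (n + 2) ^ 2 ≤ b ^ Nat.clog b ((n + 2) ^ 2) :=
  Nat.le_pow_clog hb _

theorem pow_clog_le (hb : 2 ≤ b) (n : ℕ) :
    b ^ Nat.clog b ((n + 2) ^ 2) ≤ b * (n + 2) ^ 2 := by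
  have h : 1 < (n + 2) ^ 2 := Nat.one_lt_pow two_ne_zero (by omega)
  have h1 := Nat.pow_pred_clog_lt_self (b := b) hb h
  have h2 : 0 < Nat.clog b ((n + 2) ^ 2) := Nat.clog_pos hb h
  calc _ = b * b ^ (Nat.clog b ((n + 2) ^ 2) - 1) := by rw [← pow_succ']; congr 1; omega
    _ ≤ _ := Nat.mul_le_mul_left _ h1.le

theorem pow_le_sizeSeq (hb : 2 ≤ b) (L n : ℕ) :
    (b : ℝ) ^ (levelSeq b L n) ≤ 2 * (b : ℝ) ^ L * sizeSeq b n := by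
  -- The retained fraction Π (1 - 1/(i+2)^2) over i < n telescopes to (n+2)/(2(n+1)), which exceeds
  -- 1/2; the exact value is what the induction carries.
  suffices h : ((n : ℝ) + 2) * (b : ℝ) ^ (levelSeq b L n) ≤
      2 * (n + 1) * ((b : ℝ) ^ L * sizeSeq b n) by
    have hpos : 0 ≤ (b : ℝ) ^ (levelSeq b L n) := by positivity
    have hn : (0 : ℝ) < n + 1 := by positivity
    refine le_of_mul_le_mul_left ?_ hn
    linarith
  induction n with
  | zero => simp [levelSeq, sizeSeq]
  | succ n ih =>
    have hN := sq_le_pow_clog hb n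
    set N := b ^ Nat.clog b ((n + 2) ^ 2) with hNdef
    have h1 : sizeSeq b (n + 1) = (N - 1) * sizeSeq b n := rfl
    have hN1 : 1 ≤ N := le_trans (Nat.one_le_pow _ _ (by omega)) hN
    have hNr : ((n : ℝ) + 2) ^ 2 ≤ N := by exact_mod_cast hN
    have hN1r : (1 : ℝ) ≤ N := by exact_mod_cast hN1
    have h2 : (b : ℝ) ^ Nat.clog b ((n + 2) ^ 2) = N := by rw [hNdef]; push_cast; rfl
    rw [h1, levelSeq_succ, pow_add, h2]
    push_cast [Nat.cast_sub hN1]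
    set B := (b : ℝ) ^ (levelSeq b L n)
    have hB : 0 ≤ B := by positivity
    set X := (b : ℝ) ^ L * sizeSeq b n with hX
    have hn : (0 : ℝ) < n + 1 := by positivity
    refine le_of_mul_le_mul_left ?_ hn
    have h3 : ((n : ℝ) + 1) * (n + 3) * N ≤ (N - 1) * (n + 2) ^ 2 := by nlinarith
    have h4 := mul_le_mul_of_nonneg_left ih (mul_nonneg (sub_nonneg.2 hN1r)
      (by positivity : (0 : ℝ) ≤ n + 2))
    have h5 := mul_le_mul_of_nonneg_right h3 hB
    have h6 : (b : ℝ) ^ L * ((N - 1) * sizeSeq b n) = (N - 1) * X := by rw [hX]; ring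
    rw [h6]
    linarith

theorem sizeSeq_tendsto (hb : 2 ≤ b) : Tendsto (sizeSeq b) atTop atTop := by
  have h : ∀ n, n ≤ 2 * sizeSeq b n := fun n => by
    have h1 := pow_le_sizeSeq hb 0 n
    have h2 := (le_levelSeq hb 0 n).trans (Nat.lt_pow_self (n := levelSeq b 0 n) hb).le
    have h3 : b ^ levelSeq b 0 n ≤ 2 * sizeSeq b n := by
      have : ((b ^ levelSeq b 0 n : ℕ) : ℝ) ≤ (2 * sizeSeq b n : ℕ) := by
        push_cast; simpa using h1
      exact_mod_cast this
    omega
  refine tendsto_atTop.2 fun m => ?_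
  filter_upwards [eventually_ge_atTop (2 * m)] with n hn
  have := h n
  omega

/-- The eighth term of the exponential series suffices, as 1024 · 8! ≤ 100^8. The bound is the
square of 1/(32 B^2 x^4), so that q_n matches p_n^2 in the recursion. -/
theorem exp_neg_mul_le {B x t : ℝ} (hB : 1 ≤ B) (hx : 0 < x) (ht : 100 * B * x ≤ t) :
    Real.exp (-t) ≤ (1024 * B ^ 4 * x ^ 8)⁻¹ := by
  rw [Real.exp_neg]
  refine inv_anti₀ (by positivity) ?_
  have h0 : 0 ≤ t := le_trans (by positivity) ht
  refine le_trans ?_ (Real.pow_div_factorial_le_exp t h0 8)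
  rw [le_div_iff₀ (by positivity)]
  calc 1024 * B ^ 4 * x ^ 8 * (Nat.factorial 8 : ℝ)
      = 41287680 * (B ^ 4 * x ^ 8) := by norm_num [Nat.factorial]; ring
    _ ≤ 100 ^ 8 * (B ^ 8 * x ^ 8) := by
        have : B ^ 4 ≤ B ^ 8 := pow_le_pow_right₀ hB (by norm_num)
        gcongr
        norm_num
    _ = (100 * B * x) ^ 8 := by ring
    _ ≤ t ^ 8 := by gcongr

/-- Level 0 never fails. Afterwards b^{-2k} costs about (n+2)^{-4} in the exponent of q_n, so growth
(n+2)^5 of f leaves one factor n+2, enough to beat any power. -/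
theorem percLaw_cluster_eq_empty_le [NeZero b] (hb : 2 ≤ b) {f : ℕ → ℝ≥0} (hf : Monotone f)
    {L : ℕ} {c : ℝ} (hc : 0 ≤ c) (hgrow : ∀ n : ℕ, c * ((n : ℝ) + 2) ^ 5 ≤ f (levelSeq b L n)) {lam : ℝ≥0}
    (hlam : 100 * (b : ℝ) ≤ lam * (c / (4 * (b : ℝ) ^ (2 * L + 2)))) (n : ℕ) (x : SumZ b) :
    percLaw (zoomWeight b f) lam {ω | cluster (levelSeq b L) (sizeSeq b) ω n x = ∅} ≤
      ENNReal.ofReal ((32 * (b : ℝ) ^ 2 * ((n : ℝ) + 2) ^ 4)⁻¹) := by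
  have hb1 : (1 : ℝ) ≤ b := by exact_mod_cast (by omega : 1 ≤ b)
  have hb0 : (0 : ℝ) < b := by linarith
  induction n generalizing x with
  | zero => simp [cluster]
  | succ n ih =>
    have hk : levelSeq b L (n + 1) - levelSeq b L n = Nat.clog b ((n + 2) ^ 2) := by
      rw [levelSeq_succ]; omega
    have hN' := pow_clog_le hb n
    have hs1 : 0 < sizeSeq b (n + 1) := by
      have h := pow_le_sizeSeq hb L (n + 1)
      have hp : 0 < (b : ℝ) ^ levelSeq b L (n + 1) := by positivity
      by_contra h0
      rw [show sizeSeq b (n + 1) = 0 by omega] at h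
      simp at h
      linarith
    refine (percLaw_cluster_succ_eq_empty_le hf (levelSeq_mono b L) le_rfl hs1
      (by rw [hk, sizeSeq]) ih x).trans ?_
    set y : ℝ := (n : ℝ) + 2 with hy
    have hy0 : 0 < y := by positivity
    set k := Nat.clog b ((n + 2) ^ 2) with hkdef
    have hNr : (b : ℝ) ^ k ≤ b * y ^ 2 := by rw [hy]; exact_mod_cast hN'
    have hq : Real.exp (-(lam * ((sizeSeq b n : ℝ) ^ 2 *
        ((b : ℝ) ^ (2 * levelSeq b L (n + 1)))⁻¹ * f (levelSeq b L n)))) ≤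
        (1024 * (b : ℝ) ^ 4 * y ^ 8)⁻¹ := by
      refine exp_neg_mul_le hb1 hy0 ?_
      have hsz : (2 * (b : ℝ) ^ L)⁻¹ * (b : ℝ) ^ levelSeq b L n ≤ sizeSeq b n := by
        rw [inv_mul_le_iff₀ (by positivity)]; exact pow_le_sizeSeq hb L n
      have h1 : (2 * (b : ℝ) ^ L)⁻¹ ^ 2 * (b * y ^ 2)⁻¹ ^ 2 ≤ (sizeSeq b n : ℝ) ^ 2 *
          ((b : ℝ) ^ (2 * levelSeq b L (n + 1)))⁻¹ := by
        calc _ ≤ (2 * (b : ℝ) ^ L)⁻¹ ^ 2 * ((b : ℝ) ^ k)⁻¹ ^ 2 := by gcongr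
          _ = ((2 * (b : ℝ) ^ L)⁻¹ * (b : ℝ) ^ levelSeq b L n) ^ 2 *
              ((b : ℝ) ^ (2 * levelSeq b L (n + 1)))⁻¹ := by
            rw [levelSeq_succ, ← hkdef, mul_comm 2 (_ + _), pow_mul, pow_add]
            field_simp
          _ ≤ _ := by gcongr
      calc 100 * (b : ℝ) * y ≤ lam * (c / (4 * (b : ℝ) ^ (2 * L + 2))) * y := by gcongr
        _ = lam * ((2 * (b : ℝ) ^ L)⁻¹ ^ 2 * (b * y ^ 2)⁻¹ ^ 2 * (c * y ^ 5)) := by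
          rw [pow_add, mul_comm 2 L, pow_mul]
          field_simp
          norm_num
        _ ≤ _ := mul_le_mul_of_nonneg_left
          (mul_le_mul h1 (hgrow n) (by positivity) (by positivity)) lam.coe_nonneg
    rw [hk, ← ENNReal.ofReal_pow (by positivity), ← ENNReal.ofReal_add (by positivity)
      (Real.exp_pos _).le, show (b : ℝ≥0∞) ^ (2 * k) = ENNReal.ofReal ((b : ℝ) ^ (2 * k)) by
        rw [ENNReal.ofReal_pow hb0.le, ENNReal.ofReal_natCast], ← ENNReal.ofReal_mul (by positivity)]
    refine ENNReal.ofReal_le_ofReal ?_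
    -- Both terms are 1/(1024 b^4 y^8), so the total is 1/(512 b^2 y^4). The spare factor 16 pays
    -- for passing from y to y + 1 ≤ 2y.
    calc _ ≤ (b * y ^ 2) ^ 2 * ((32 * (b : ℝ) ^ 2 * y ^ 4)⁻¹ ^ 2 +
          (1024 * (b : ℝ) ^ 4 * y ^ 8)⁻¹) := by
          rw [mul_comm 2 k, pow_mul]
          gcongr
      _ = (32 * (b : ℝ) ^ 2 * (16 * y ^ 4))⁻¹ := by field_simp; norm_num
      _ ≤ _ := by
          refine inv_anti₀ (by positivity) ?_
          have h2 : ((n + 1 : ℕ) : ℝ) + 2 ≤ 2 * y := by push_cast; linarith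
          have h3 : (((n + 1 : ℕ) : ℝ) + 2) ^ 4 ≤ (2 * y) ^ 4 := by gcongr
          have h4 : (2 * y) ^ 4 = 16 * y ^ 4 := by ring
          rw [h4] at h3
          gcongr

theorem sum_range_inv_pow_four_le (n : ℕ) :
    ∑ i ∈ Finset.range n, (((i : ℝ) + 2) ^ 4)⁻¹ ≤ 1 := by
  suffices h : ∑ i ∈ Finset.range n, (((i : ℝ) + 2) ^ 4)⁻¹ ≤ 1 - ((n : ℝ) + 1)⁻¹ by
    have : 0 ≤ ((n : ℝ) + 1)⁻¹ := by positivity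
    linarith
  induction n with
  | zero => simp
  | succ n ih =>
    rw [Finset.sum_range_succ]
    have hn : (0 : ℝ) ≤ n := n.cast_nonneg
    have h1 : (((n : ℝ) + 2) ^ 4)⁻¹ ≤ (((n : ℝ) + 1) * (n + 2))⁻¹ := by
      refine inv_anti₀ (by positivity) ?_
      calc ((n : ℝ) + 1) * (n + 2) ≤ (n + 2) ^ 2 := by nlinarith
        _ ≤ (n + 2) ^ 4 := pow_le_pow_right₀ (by linarith) (by norm_num)
    have h2 : (((n : ℝ) + 1) * (n + 2))⁻¹ = ((n : ℝ) + 1)⁻¹ - ((n : ℝ) + 2)⁻¹ := by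
      field_simp; ring
    push_cast
    rw [add_assoc (n : ℝ) 1 1, one_add_one_eq_two]
    linarith

theorem lambdaC_lt_top (hb : 2 ≤ b) {f : ℕ → ℝ≥0} (hf : Monotone f) {a : ℝ} (ha : 1 < a)
    (hgrow : (fun l : ℕ => a ^ Real.sqrt (l : ℝ)) =O[atTop] (fun l : ℕ => (f l : ℝ))) :
    lambdaC (zoomWeight b f) < ⊤ := by
  have : NeZero b := ⟨by omega⟩
  have hb1 : (1 : ℝ) ≤ b := by exact_mod_cast (by omega : 1 ≤ b)
  have hb0 : (0 : ℝ) < b := by linarith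
  obtain ⟨C, hC, hbound⟩ := hgrow.exists_pos
  obtain ⟨K, hK⟩ := eventually_atTop.1 hbound.bound
  set L := max K 2 with hL
  -- From the tenth term of the series for exp(√l log a): its power (√l)^10 = l^5 gives the fifth
  -- power required, and l_n ≥ n + 2 because L ≥ 2.
  set c : ℝ := C⁻¹ * (Real.log a ^ 10 / (Nat.factorial 10 : ℝ)) with hc
  have hlog : 0 < Real.log a := Real.log_pos ha
  have hc0 : 0 < c := by positivity
  have hlevel : ∀ n : ℕ, c * ((n : ℝ) + 2) ^ 5 ≤ f (levelSeq b L n) := by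
    intro n
    have h1 := le_levelSeq hb L n
    have h2 := hK (levelSeq b L n) (by omega)
    rw [Real.norm_of_nonneg (NNReal.coe_nonneg _),
      Real.norm_of_nonneg (Real.rpow_nonneg (by linarith) _)] at h2
    set t := Real.sqrt (levelSeq b L n : ℝ) with ht
    have ht2 : (n : ℝ) + 2 ≤ t ^ 2 := by
      rw [ht, Real.sq_sqrt (Nat.cast_nonneg _)]
      exact_mod_cast (by omega : n + 2 ≤ levelSeq b L n)
    have ht0 : 0 ≤ t := Real.sqrt_nonneg _
    have h3 : Real.log a ^ 10 / (Nat.factorial 10 : ℝ) * ((n : ℝ) + 2) ^ 5 ≤ a ^ t := by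
      rw [Real.rpow_def_of_pos (by linarith)]
      refine le_trans ?_ (Real.pow_div_factorial_le_exp _ (by positivity) 10)
      rw [div_mul_eq_mul_div, mul_pow]
      gcongr
      calc ((n : ℝ) + 2) ^ 5 ≤ (t ^ 2) ^ 5 := by gcongr
        _ = t ^ 10 := by ring
    rw [hc, mul_assoc, inv_mul_le_iff₀ hC]
    exact h3.trans h2
  set d : ℝ := c / (4 * (b : ℝ) ^ (2 * L + 2)) with hd
  have hd0 : 0 < d := by positivity
  refine lt_of_le_of_lt (b := ((Real.toNNReal (100 * b / d) : ℝ≥0) : ℝ≥0∞)) ?_ ENNReal.coe_lt_top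
  refine iSup₂_le fun lam hlam => ?_
  -- Every intensity above 100b/d percolates, so it cannot enter the supremum; no monotonicity in
  -- the intensity is needed.
  by_contra hlt
  rw [not_le, ENNReal.coe_lt_coe] at hlt
  have hlam' : 100 * (b : ℝ) ≤ lam * d := by
    rw [← div_le_iff₀ hd0]
    exact (Real.le_coe_toNNReal _).trans (by exact_mod_cast hlt.le)
  refine percLaw_infiniteComponent_ne_zero (l := levelSeq b L) (s := sizeSeq b) le_rfl
    (sizeSeq_tendsto hb) ?_ hlam
  refine lt_of_le_of_lt (b := ENNReal.ofReal (32⁻¹)) ?_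
    (by rw [ENNReal.ofReal_lt_one]; norm_num)
  refine (ENNReal.tsum_le_tsum fun n =>
    percLaw_cluster_eq_empty_le hb hf hc0.le hlevel hlam' n 0).trans ?_
  refine ENNReal.tsum_le_of_sum_range_le fun n => ?_
  rw [← ENNReal.ofReal_sum_of_nonneg fun _ _ => by positivity]
  refine ENNReal.ofReal_le_ofReal ?_
  calc ∑ i ∈ Finset.range n, (32 * (b : ℝ) ^ 2 * ((i : ℝ) + 2) ^ 4)⁻¹
      ≤ ∑ i ∈ Finset.range n, 32⁻¹ * (((i : ℝ) + 2) ^ 4)⁻¹ := by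
        refine Finset.sum_le_sum fun i _ => ?_
        rw [← mul_inv]
        refine inv_anti₀ (by positivity) ?_
        gcongr
        exact le_mul_of_one_le_right (by norm_num) (one_le_pow₀ hb1)
    _ = 32⁻¹ * ∑ i ∈ Finset.range n, (((i : ℝ) + 2) ^ 4)⁻¹ := by rw [Finset.mul_sum]
    _ ≤ 32⁻¹ * 1 := by gcongr; exact sum_range_inv_pow_four_le n
    _ = _ := mul_one _

end Supercritical

/-! ### Growth of log l / log log l. -/

section LogOverLogLog

theorem tendsto_log_natCast_atTop : Tendsto (fun l : ℕ => Real.log (l : ℝ)) atTop atTop :=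
  Real.tendsto_log_atTop.comp tendsto_natCast_atTop_atTop

theorem isLittleO_log_div_log_log :
    (fun l : ℕ => Real.log (l : ℝ) / Real.log (Real.log (l : ℝ))) =o[atTop]
      fun l : ℕ => Real.log (l : ℝ) := by
  have h : (fun l : ℕ => (Real.log (Real.log (l : ℝ)))⁻¹) =o[atTop] fun _ : ℕ => (1 : ℝ) :=
    (isLittleO_one_iff ℝ).2
      (Real.tendsto_log_atTop.comp tendsto_log_natCast_atTop).inv_tendsto_atTop
  simpa [div_eq_mul_inv] using (isBigO_refl (fun l : ℕ => Real.log (l : ℝ)) atTop).mul_isLittleO h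

theorem tendsto_log_div_log_log :
    Tendsto (fun l : ℕ => Real.log (l : ℝ) / Real.log (Real.log (l : ℝ))) atTop atTop := by
  have h : Tendsto (fun u : ℝ => u / Real.log u) atTop atTop := by
    have h1 : Tendsto (fun u : ℝ => Real.log u / u) atTop (𝓝[>] 0) := by
      refine tendsto_nhdsWithin_iff.2 ⟨Real.isLittleO_log_id_atTop.tendsto_div_nhds_zero, ?_⟩
      filter_upwards [eventually_gt_atTop 1] with u hu
      exact div_pos (Real.log_pos hu) (by linarith)
    exact h1.inv_tendsto_nhdsGT_zero.congr fun u => inv_div _ _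
  exact h.comp tendsto_log_natCast_atTop

end LogOverLogLog

end LongRangePerc

theorem mainTheorem9 (b : ℕ) (hb : 2 ≤ b) (f : ℕ → ℝ≥0) (hf : Monotone f) :
    (∀ a : ℝ, 1 < a →
      (fun l : ℕ => a ^ Real.sqrt (l : ℝ)) =O[atTop] (fun l : ℕ => (f l : ℝ)) →
      LongRangePerc.lambdaC (LongRangePerc.zoomWeight b f) < ⊤) ∧
    ((fun l : ℕ => (f l : ℝ)) =o[atTop] (fun l : ℕ => Real.log (l : ℝ)) →
      LongRangePerc.UltimatelyConcave f →
      LongRangePerc.lambdaC (LongRangePerc.zoomWeight b f) = ⊤) ∧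
    (Tendsto f atTop atTop →
      Tendsto (LongRangePerc.minBoundary (LongRangePerc.zoomWeight b f)) atTop (𝓝 ⊤)) ∧
    ((∀ᶠ l : ℕ in atTop, (f l : ℝ) = Real.log (l : ℝ) / Real.log (Real.log (l : ℝ))) →
      LongRangePerc.lambdaC (LongRangePerc.zoomWeight b f) = ⊤ ∧
      Tendsto (LongRangePerc.minBoundary (LongRangePerc.zoomWeight b f)) atTop (𝓝 ⊤)) := by
  have : NeZero b := ⟨by omega⟩
  refine ⟨fun a ha h => LongRangePerc.lambdaC_lt_top hb hf ha h,
    fun h _ => LongRangePerc.lambdaC_eq_top hb hf h,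
    LongRangePerc.tendsto_minBoundary hb hf, fun h => ⟨LongRangePerc.lambdaC_eq_top hb hf ?_,
      LongRangePerc.tendsto_minBoundary hb hf ?_⟩⟩
  · exact LongRangePerc.isLittleO_log_div_log_log.congr' (h.mono fun _ hl => hl.symm)
      (EventuallyEq.refl _ _)
  · rw [← NNReal.tendsto_coe_atTop]
    exact LongRangePerc.tendsto_log_div_log_log.congr' (h.mono fun _ hl => hl.symm)
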